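/- **Definitions.** For $n=(n_1,n_2,n_3,n_4)$ with all $n_i\ge 1$ and $r=n_1+\dots+n_4$, the 4-cycle algebra $A(n)\subseteq M_r(\mathbb C)$ consists of the matrices, partitioned into blocks of sizes $n_1,\dots,n_4$, whose $(i,j)$ block vanishes unless $i=j$ or $i\in\{1,2\},\ j\in\{3,4\}$ (i.e. unless $(i,j)$ is an edge of the digraph $D_4$). A *star extendible embedding* $\phi:A(m)\to A(n)$ is an injective algebra homomorphism which extends to a (not necessarily unital) star homomorphism $C^*(A(m))\to C^*(A(n))$ between the full matrix algebras generated; it has *multiplicity one* if it maps rank one elements to rank one elements. A direct sum of maps is a finite sum of maps with mutually orthogonal ranges. A multiplicity one star extendible embedding is *rigid* if, for one of the four symmetries $\sigma$ of $D_4$ (its type), it maps the $(i,j)$ block subspace into the $(\sigma(i),\sigma(j))$ block subspace for every edge $(i,j)$ of $D_4$. A star extendible embedding is *regular* if it is a direct sum of multiplicity one star extendible embeddings, *rigid* if it is a direct sum of multiplicity one rigid embeddings, and *generic* if it is a direct sum of multiplicity one rigid embeddings in which each of the four types occurs. A *generic system* of 4-cycle algebras is a sequence $\mathcal A=(A_k,\alpha_k)_{k\ge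 0}$ of 4-cycle algebras with rigid embeddings $\alpha_k:A_k\to A_{k+1}$, infinitely many of which are generic. Its algebraic direct limit is $A=\varinjlim A_k$, a subalgebra of the complex star algebra $B=\varinjlim C^*(A_k)$ which it generates. The limits $A,A'$ of two systems are *star extendibly isomorphic* if there is an algebra isomorphism $A\to A'$ which extends to a star isomorphism $B\to B'$. Systems $\mathcal A,\mathcal A'$ are *regularly isomorphic* if there are strictly increasing sequences $(n_k)$, $(m_k)$ and regular star extendible embeddings $\phi_k:A_{n_k}\to A'_{m_k}$, $\psi_k:A'_{m_k}\to A_{n_{k+1}}$ such that, for all $k$, $\psi_k\circ\phi_k$ is the given embedding $A_{n_k}\to A_{n_{k+1}}$ and $\phi_{k+1}\circ\psi_k$ is the given embedding $A'_{m_k}\to A'_{m_{k+1}}$. **Theorem.** Let $\mathcal A,\mathcal A'$ be generic systems of 4-cycle algebras, with algebraic direct limits $A,A'$. Then $A$ and $A'$ are star extendibly isomorphic if and only if $\mathcal A$ and $\mathcal A'$ are regularly isomorphic. -/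

import Mathlib

open Filter

namespace FourCycle

/-- The edges of the digraph `D_4` (vertices `0, 1, 2, 3`): the four loops and the four edges
joining a vertex of `{0, 1}` to a vertex of `{2, 3}`. A pair `(i, j)` is an edge exactly when the
matrix unit `e_{ij}` of `M_4` lies in `A(D_4)`. -/
def Edge (i j : Fin 4) : Prop := i = j ∨ (i.val < 2 ∧ 2 ≤ j.val)

/-- The index set of partitioned matrices with block sizes `n 0, n 1, n 2, n 3`. -/
abbrev Idx (n : Fin 4 → ℕ) : Type := Σ i : Fin 4, Fin (n i)

/-- The full matrix algebra `M_r`, `r = n 0 + n 1 + n 2 + n 3`, with its partition into blocks. -/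
abbrev Mat (n : Fin 4 → ℕ) : Type := Matrix (Idx n) (Idx n) ℂ

/-- The 4-cycle matrix algebra with block sizes `n 0, n 1, n 2, n 3`: the partitioned matrices
whose `(i, j)` block vanishes whenever `(i, j)` is not an edge of `D_4`. -/
def algebra (n : Fin 4 → ℕ) : Subalgebra ℂ (Mat n) where
  carrier := {a | ∀ p q : Idx n, ¬ Edge p.1 q.1 → a p q = 0}
  mul_mem' := by
    intro a b ha hb p q hpq
    rw [Matrix.mul_apply]
    refine Finset.sum_eq_zero fun s _ => ?_
    by_cases h1 : Edge p.1 s.1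
    · have h2 : ¬ Edge s.1 q.1 := by
        intro h2
        apply hpq
        unfold Edge at *
        grind
      rw [hb s q h2, mul_zero]
    · rw [ha p s h1, zero_mul]
  add_mem' := by
    intro a b ha hb p q hpq
    simp [ha p q hpq, hb p q hpq]
  algebraMap_mem' := by
    intro c p q hpq
    have hne : p ≠ q := by
      rintro rfl
      exact hpq (Or.inl rfl)
    simp [Matrix.algebraMap_matrix_apply, hne]

/-- The block subspace `e_{ij} M`: the matrices supported in the `(i, j)` block. -/
def block (n : Fin 4 → ℕ) (i j : Fin 4) : Set (Mat n) :=
  {a | ∀ p q : Idx n, ¬ (p.1 = i ∧ q.1 = j) → a p q = 0}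

/-- When all four blocks are nonempty, the C*-algebra generated by the 4-cycle algebra is the full
matrix algebra. Hence a star extendible map between 4-cycle algebras is the same thing as a
star homomorphism between the full matrix algebras which maps one 4-cycle algebra into the other,
and such maps are represented below by these (unique) star extensions. -/
theorem adjoin_algebra (n : Fin 4 → ℕ) (hn : ∀ i, 0 < n i) :
    NonUnitalStarAlgebra.adjoin ℂ (algebra n : Set (Mat n)) = ⊤ := by
  classical
  set S := NonUnitalStarAlgebra.adjoin ℂ (algebra n : Set (Mat n)) with hS
  have hE : ∀ (p q : Idx n) (c : ℂ), Edge p.1 q.1 → Matrix.single p q c ∈ S := by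
    intro p q c h
    apply NonUnitalStarAlgebra.subset_adjoin
    intro p' q' h'
    rw [Matrix.single_apply, if_neg]
    rintro ⟨rfl, rfl⟩
    exact h' h
  have hE' : ∀ (p q : Idx n) (c : ℂ), Edge q.1 p.1 → Matrix.single p q c ∈ S := by
    intro p q c h
    have h1 := star_mem (hE q p (star c) h)
    rwa [Matrix.star_eq_conjTranspose, Matrix.conjTranspose_single, star_star] at h1
  have hall : ∀ (p q : Idx n) (c : ℂ), Matrix.single p q c ∈ S := by
    intro p q c
    have key : ∃ s : Idx n, (Edge p.1 s.1 ∨ Edge s.1 p.1) ∧ (Edge s.1 q.1 ∨ Edge q.1 s.1) := by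
      by_cases hp : p.1.val < 2
      · by_cases hq : q.1.val < 2
        · exact ⟨⟨2, ⟨0, hn 2⟩⟩, Or.inl (Or.inr ⟨hp, by simp⟩), Or.inr (Or.inr ⟨hq, by simp⟩)⟩
        · exact ⟨p, Or.inl (Or.inl rfl), Or.inl (Or.inr ⟨hp, by omega⟩)⟩
      · by_cases hq : q.1.val < 2
        · exact ⟨p, Or.inl (Or.inl rfl), Or.inr (Or.inr ⟨hq, by omega⟩)⟩
        · exact ⟨⟨0, ⟨0, hn 0⟩⟩, Or.inr (Or.inr ⟨by simp, by omega⟩),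
            Or.inl (Or.inr ⟨by simp, by omega⟩)⟩
    obtain ⟨s, h1, h2⟩ := key
    have e1 : Matrix.single p s c ∈ S := h1.elim (hE p s c) (hE' p s c)
    have e2 : Matrix.single s q (1 : ℂ) ∈ S := h2.elim (hE s q 1) (hE' s q 1)
    have e3 := mul_mem e1 e2
    rwa [Matrix.single_mul_single_same, mul_one] at e3
  refine eq_top_iff.2 fun a _ => ?_
  rw [Matrix.matrix_eq_sum_single a]
  exact sum_mem fun i _ => sum_mem fun j _ => hall i j _

/-- `φ` is (the star extension of) a star extendible embedding of 4-cycle algebras. -/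
def IsStarExtEmbedding {m n : Fin 4 → ℕ} (φ : Mat m →⋆ₙₐ[ℂ] Mat n) : Prop :=
  Function.Injective φ ∧ ∀ a ∈ algebra m, φ a ∈ algebra n

/-- `φ` is the direct sum of the maps `f t`: it is their sum and the `f t` have mutually
orthogonal ranges. -/
def IsDirectSum {m n : Fin 4 → ℕ} {s : ℕ} (φ : Mat m →⋆ₙₐ[ℂ] Mat n)
    (f : Fin s → (Mat m →⋆ₙₐ[ℂ] Mat n)) : Prop :=
  (∀ t u, t ≠ u → ∀ x y, f t x * f u y = 0) ∧ ∀ x, φ x = ∑ t, f t x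

/-- Multiplicity one star extendible embeddings of 4-cycle algebras: elements of rank one are
mapped to elements of rank one. -/
def IsMultiplicityOne {m n : Fin 4 → ℕ} (φ : Mat m →⋆ₙₐ[ℂ] Mat n) : Prop :=
  IsStarExtEmbedding φ ∧ ∀ x : Mat m, x.rank = 1 → (φ x).rank = 1

/-- The symmetries of the digraph `D_4` (there are four of them). -/
def IsSymmetry (σ : Equiv.Perm (Fin 4)) : Prop := ∀ i j, Edge i j ↔ Edge (σ i) (σ j)

/-- Multiplicity one rigid embeddings, with their type: the embedding maps the block subspace of
each edge `(i, j)` of `D_4` into the block subspace of the edge `(σ i, σ j)`, for the symmetry `σ`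
of `D_4`. In particular the four off-diagonal block subspaces are mapped into distinct
off-diagonal block subspaces. -/
def IsRigidOfType {m n : Fin 4 → ℕ} (σ : Equiv.Perm (Fin 4)) (φ : Mat m →⋆ₙₐ[ℂ] Mat n) : Prop :=
  IsSymmetry σ ∧ IsMultiplicityOne φ ∧
    ∀ i j, Edge i j → ∀ x ∈ block m i j, φ x ∈ block n (σ i) (σ j)

/-- Regular star extendible embeddings: direct sums of multiplicity one embeddings. -/
def IsRegular {m n : Fin 4 → ℕ} (φ : Mat m →⋆ₙₐ[ℂ] Mat n) : Prop :=
  IsStarExtEmbedding φ ∧ ∃ (s : ℕ) (f : Fin s → (Mat m →⋆ₙₐ[ℂ] Mat n)),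
    IsDirectSum φ f ∧ ∀ t, IsMultiplicityOne (f t)

/-- Rigid embeddings: direct sums of multiplicity one rigid embeddings. (This class is invariant
under conjugation by unitaries of the range algebra.) -/
def IsRigid {m n : Fin 4 → ℕ} (φ : Mat m →⋆ₙₐ[ℂ] Mat n) : Prop :=
  IsStarExtEmbedding φ ∧ ∃ (s : ℕ) (f : Fin s → (Mat m →⋆ₙₐ[ℂ] Mat n)),
    IsDirectSum φ f ∧ ∀ t, ∃ σ, IsRigidOfType σ (f t)

/-- Generic embeddings: direct sums of multiplicity one rigid embeddings with at least one summand
of each of the four types. (This class is invariant under conjugation by unitaries of the range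
algebra.) -/
def IsGenericEmbedding {m n : Fin 4 → ℕ} (φ : Mat m →⋆ₙₐ[ℂ] Mat n) : Prop :=
  IsStarExtEmbedding φ ∧ ∃ (s : ℕ) (f : Fin s → (Mat m →⋆ₙₐ[ℂ] Mat n)),
    IsDirectSum φ f ∧ (∀ t, ∃ σ, IsRigidOfType σ (f t)) ∧
      ∀ σ, IsSymmetry σ → ∃ t, IsRigidOfType σ (f t)

/-- A direct system `A_0 → A_1 → ⋯` of 4-cycle algebras and star extendible embeddings. -/
structure DirectSys where
  /-- the block sizes of the algebras -/
  dim : ℕ → Fin 4 → ℕ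
  dim_pos : ∀ k i, 0 < dim k i
  /-- the (star extensions of the) embeddings -/
  map : ∀ k, Mat (dim k) →⋆ₙₐ[ℂ] Mat (dim (k + 1))
  map_emb : ∀ k, IsStarExtEmbedding (map k)

namespace DirectSys

variable (S : DirectSys)

/-- A generic system: the embeddings are rigid and infinitely many of them are generic. -/
def IsGeneric : Prop :=
  (∀ k, IsRigid (S.map k)) ∧ ∃ᶠ k in atTop, IsGenericEmbedding (S.map k)

/-- The composed embedding from the `i`-th to the `j`-th algebra, `i ≤ j`. -/
def trans (i j : ℕ) (h : i ≤ j) : Mat (S.dim i) →⋆ₙₐ[ℂ] Mat (S.dim j) :=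
  Nat.leRec (motive := fun j _ => Mat (S.dim i) →⋆ₙₐ[ℂ] Mat (S.dim j))
    (NonUnitalStarAlgHom.id ℂ (Mat (S.dim i))) (fun k _ f => (S.map k).comp f) h

theorem trans_self (i : ℕ) : S.trans i i le_rfl = NonUnitalStarAlgHom.id ℂ (Mat (S.dim i)) :=
  Nat.leRec_self _ _

theorem trans_succ (i j : ℕ) (h : i ≤ j) :
    S.trans i (j + 1) (h.trans (Nat.le_succ j)) = (S.map j).comp (S.trans i j h) :=
  Nat.leRec_succ _ _ _

theorem trans_comp {i j k : ℕ} (hij : i ≤ j) (hjk : j ≤ k) :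
    (S.trans j k hjk).comp (S.trans i j hij) = S.trans i k (hij.trans hjk) := by
  induction k, hjk using Nat.le_induction with
  | base => rw [trans_self]; rfl
  | succ k hjk ih => rw [trans_succ _ _ _ hjk, trans_succ _ _ _ (hij.trans hjk), ← ih]; rfl

theorem trans_mem {i j : ℕ} (hij : i ≤ j) {a : Mat (S.dim i)} (ha : a ∈ algebra (S.dim i)) :
    S.trans i j hij a ∈ algebra (S.dim j) := by
  induction j, hij using Nat.le_induction with
  | base => rw [trans_self]; exact ha
  | succ k hik ih => rw [trans_succ _ _ _ hik]; exact (S.map_emb k).2 _ ih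

instance : DirectedSystem (fun k => Mat (S.dim k)) (fun i j h => S.trans i j h) where
  map_self i x := by rw [trans_self]; rfl
  map_map k j i hij hjk x := by rw [← S.trans_comp hij hjk]; rfl

/-- The algebraic direct limit of the star algebras `C*(A_k)`, which are full matrix algebras. -/
abbrev starLimit : Type := DirectLimit (fun k => Mat (S.dim k)) S.trans

/-- The algebraic direct limit `A = alg lim A_k`, realised (the connecting maps being injective)
as the union of the images of the `A_k` in the direct limit of the `C*(A_k)`. -/
def limit : NonUnitalSubalgebra ℂ S.starLimit where
  carrier := {x | ∃ k, ∃ a ∈ algebra (S.dim k), x = (⟦⟨k, a⟩⟧ : S.starLimit)}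
  zero_mem' := ⟨0, 0, zero_mem _, DirectLimit.zero_def 0⟩
  add_mem' := by
    rintro _ _ ⟨k, a, ha, rfl⟩ ⟨l, b, hb, rfl⟩
    refine ⟨max k l, _, add_mem (S.trans_mem (le_max_left k l) ha)
      (S.trans_mem (le_max_right k l) hb), ?_⟩
    rw [← DirectLimit.add_def, DirectLimit.mk_apply, DirectLimit.mk_apply]
  mul_mem' := by
    rintro _ _ ⟨k, a, ha, rfl⟩ ⟨l, b, hb, rfl⟩
    refine ⟨max k l, _, mul_mem (S.trans_mem (le_max_left k l) ha)
      (S.trans_mem (le_max_right k l) hb), ?_⟩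
    rw [← DirectLimit.mul_def, DirectLimit.mk_apply, DirectLimit.mk_apply]
  smul_mem' := by
    rintro c _ ⟨k, a, ha, rfl⟩
    exact ⟨k, c • a, (algebra (S.dim k)).smul_mem ha c, rfl⟩

end DirectSys

/-- The limit algebras `A`, `A'` of two systems are star extendibly isomorphic: there is an
isomorphism `A → A'` of complex algebras which extends to a star isomorphism of the star algebras
generated by `A` and `A'`. -/
def StarExtendiblyIsomorphic (S S' : DirectSys) : Prop :=
  ∃ θ : S.limit →ₙₐ[ℂ] S'.limit, Function.Bijective θ ∧
    ∃ Φ : S.starLimit ≃⋆ₐ[ℂ] S'.starLimit, ∀ a : S.limit, Φ a = θ a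

/-- Two systems are regularly isomorphic: there are subsystems and regular star extendible
embeddings `φ k : A_{n k} → A'_{m k}`, `ψ k : A'_{m k} → A_{n (k + 1)}` forming with the given
embeddings an infinite commuting diagram
`A_{n 0} → A'_{m 0} → A_{n 1} → A'_{m 1} → ⋯`. -/
def RegularlyIsomorphic (S S' : DirectSys) : Prop :=
  ∃ (n m : ℕ → ℕ) (hn : StrictMono n) (hm : StrictMono m)
    (φ : ∀ k, Mat (S.dim (n k)) →⋆ₙₐ[ℂ] Mat (S'.dim (m k)))
    (ψ : ∀ k, Mat (S'.dim (m k)) →⋆ₙₐ[ℂ] Mat (S.dim (n (k + 1)))),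
    (∀ k, IsRegular (φ k)) ∧ (∀ k, IsRegular (ψ k)) ∧
    (∀ k, (ψ k).comp (φ k) = S.trans (n k) (n (k + 1)) (hn.monotone (Nat.le_succ k))) ∧
    (∀ k, (φ (k + 1)).comp (ψ k) = S'.trans (m k) (m (k + 1)) (hm.monotone (Nat.le_succ k)))

end FourCycle

set_option linter.unusedSectionVars false

/-! A commuting zigzag of embeddings induces an isomorphism of the limits, which settles one
direction. Conversely the algebras are finite-dimensional and the limits algebraic, so an
isomorphism and its inverse lift to a zigzag of star extendible embeddings whose consecutive
compositions are the given, rigid, maps (`exists_lift`, `StarExtendiblyIsomorphic.exists_zigzag`).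
The maps of this zigzag need not be regular, and the work is to replace them.

The way an embedding `φ` permutes the vertices of `D_4` is recorded by two self-adjoint elements
`u`, `v` of its commutant with square `φ 1`: the weight `gL = (1,-1,0,0)` acts on the range as `u *
φ (wt gL)`, and `gR = (0,0,1,-1)` as `v * φ (wt gR)`. A direct sum of rigid maps has such signs, and
they commute, being scalars `±1` on each summand. Conversely an embedding with commuting signs
splits along their joint spectral projections into rigid multiplicity one maps, so it is regular
(`IsAligned.isRegular`), and the four traces of `φ`, `uφ`, `vφ`, `uvφ` determine it up to a block
diagonal unitary (`exists_unitary_conj`).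

Since the compositions in the zigzag have signs, each factor has signs (`exists_isAligned_of_comp`).
Signs multiply under composition, and those of the compositions commute; hence the signs of the
factors either all commute or all anticommute (`commute_or_anticommute`,
`Zigzag.commuting_or_anticommuting`). In the first case the zigzag is already regular.

In the second case anticommutation forces the traces of `uφ`, `vφ`, `uvφ` to vanish, and the same
then holds for the given connecting maps between stages of the zigzag. Each factor is exchanged for
one with commuting signs and the same trace (`IsAligned.exists_commuting`). All the relevant
compositions now have vanishing sign traces and the correct ordinary trace, so they agree with the
given maps up to a unitary, and absorbing these unitaries one at a time yields a regular zigzag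
(`Zigzag.regularlyIsomorphic_of_anticommuting`). -/

namespace FourCycle

/-! ### Algebraic limits, and isomorphisms of limits as zigzags -/

namespace DirectSys

variable (S : DirectSys)

/-- The canonical map from the `k`-th star algebra of a system to the limit. -/
noncomputable def toLimit (k : ℕ) : Mat (S.dim k) →⋆ₙₐ[ℂ] S.starLimit where
  toFun a := ⟦⟨k, a⟩⟧
  map_smul' c a := (DirectLimit.smul_def (f := S.trans) k a c).symm
  map_zero' := (DirectLimit.zero_def (f := S.trans) k).symm
  map_add' a b := (DirectLimit.add_def (f := S.trans) k a b).symm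
  map_mul' a b := (DirectLimit.mul_def (f := S.trans) k a b).symm
  map_star' a := (DirectLimit.star_def (f := S.trans) k a).symm

theorem toLimit_trans {i j : ℕ} (h : i ≤ j) (a : Mat (S.dim i)) :
    S.toLimit j (S.trans i j h a) = S.toLimit i a :=
  DirectLimit.mk_apply (F := fun k => Mat (S.dim k)) (f := S.trans) i j a h

theorem trans_trans {i j k : ℕ} (hij : i ≤ j) (hjk : j ≤ k) (a : Mat (S.dim i)) :
    S.trans j k hjk (S.trans i j hij a) = S.trans i k (hij.trans hjk) a := by
  rw [← S.trans_comp hij hjk]; rfl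

theorem trans_self_apply (i : ℕ) (a : Mat (S.dim i)) : S.trans i i le_rfl a = a := by
  rw [S.trans_self]; rfl

theorem trans_injective {i j : ℕ} (h : i ≤ j) : Function.Injective (S.trans i j h) := by
  induction j, h using Nat.le_induction with
  | base => intro a b hab; simpa only [trans_self_apply] using hab
  | succ k hik ih =>
    rw [S.trans_succ i k hik]
    exact (S.map_emb k).1.comp ih

theorem toLimit_injective (k : ℕ) : Function.Injective (S.toLimit k) :=
  DirectLimit.mk_injective (f := S.trans) (fun _ _ h => S.trans_injective h) k

theorem exists_toLimit_eq (x : S.starLimit) : ∃ k a, S.toLimit k a = x := by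
  obtain ⟨k, a, rfl⟩ := DirectLimit.exists_eq_mk (f := S.trans) x
  exact ⟨k, a, rfl⟩

theorem exists_toLimit_eq_of_le (x : S.starLimit) :
    ∃ k, ∀ j, k ≤ j → ∃ a, S.toLimit j a = x := by
  obtain ⟨k, a, rfl⟩ := S.exists_toLimit_eq x
  exact ⟨k, fun j h => ⟨S.trans k j h a, S.toLimit_trans h a⟩⟩

theorem mem_limit {x : S.starLimit} :
    x ∈ S.limit ↔ ∃ k, ∃ a ∈ algebra (S.dim k), S.toLimit k a = x :=
  ⟨fun ⟨k, a, ha, h⟩ => ⟨k, a, ha, h.symm⟩, fun ⟨k, a, ha, h⟩ => ⟨k, a, ha, h.symm⟩⟩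

theorem toLimit_mem_limit {k : ℕ} {a : Mat (S.dim k)} (ha : a ∈ algebra (S.dim k)) :
    S.toLimit k a ∈ S.limit := ⟨k, a, ha, rfl⟩

theorem exists_algebra_toLimit_eq {x : S.starLimit} (hx : x ∈ S.limit) :
    ∃ k, ∀ j, k ≤ j → ∃ a ∈ algebra (S.dim j), S.toLimit j a = x := by
  obtain ⟨k, a, ha, rfl⟩ := S.mem_limit.1 hx
  exact ⟨k, fun j h => ⟨S.trans k j h a, S.trans_mem h ha, S.toLimit_trans h a⟩⟩

end DirectSys

/-- An infinite commuting diagram `A_{n 0} → A'_{m 0} → A_{n 1} → A'_{m 1} → ⋯` of star extendible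
embeddings between subsystems of two direct systems. -/
structure Zigzag (S S' : DirectSys) where
  /-- the indices of the first subsystem -/
  n : ℕ → ℕ
  /-- the indices of the second subsystem -/
  m : ℕ → ℕ
  hn : StrictMono n
  hm : StrictMono m
  /-- the embeddings of the first system into the second -/
  φ : ∀ k, Mat (S.dim (n k)) →⋆ₙₐ[ℂ] Mat (S'.dim (m k))
  /-- the embeddings of the second system into the first -/
  ψ : ∀ k, Mat (S'.dim (m k)) →⋆ₙₐ[ℂ] Mat (S.dim (n (k + 1)))
  hφ : ∀ k, IsStarExtEmbedding (φ k)
  hψ : ∀ k, IsStarExtEmbedding (ψ k)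
  ψφ : ∀ k, (ψ k).comp (φ k) = S.trans (n k) (n (k + 1)) (hn.monotone (Nat.le_succ k))
  φψ : ∀ k, (φ (k + 1)).comp (ψ k) = S'.trans (m k) (m (k + 1)) (hm.monotone (Nat.le_succ k))

namespace Zigzag

variable {S S' : DirectSys} (Z : Zigzag S S')

theorem ψφ_apply (k : ℕ) (a : Mat (S.dim (Z.n k))) :
    Z.ψ k (Z.φ k a) = S.trans (Z.n k) (Z.n (k + 1)) (Z.hn.monotone (Nat.le_succ k)) a := by
  rw [← Z.ψφ k]; rfl

theorem φψ_apply (k : ℕ) (a : Mat (S'.dim (Z.m k))) :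
    Z.φ (k + 1) (Z.ψ k a) = S'.trans (Z.m k) (Z.m (k + 1)) (Z.hm.monotone (Nat.le_succ k)) a := by
  rw [← Z.φψ k]; rfl

theorem φ_trans {k l : ℕ} (h : k ≤ l) (a : Mat (S.dim (Z.n k))) :
    Z.φ l (S.trans _ _ (Z.hn.monotone h) a) = S'.trans _ _ (Z.hm.monotone h) (Z.φ k a) := by
  induction l, h using Nat.le_induction with
  | base => rw [S.trans_self_apply, S'.trans_self_apply]
  | succ l h ih =>
    rw [← S.trans_trans (Z.hn.monotone h) (Z.hn.monotone (Nat.le_succ l)), ← Z.ψφ_apply,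
      Z.φψ_apply, ih, S'.trans_trans]

theorem ψ_trans {k l : ℕ} (h : k ≤ l) (a : Mat (S'.dim (Z.m k))) :
    Z.ψ l (S'.trans _ _ (Z.hm.monotone h) a) =
      S.trans _ _ (Z.hn.monotone (Nat.succ_le_succ h)) (Z.ψ k a) := by
  induction l, h using Nat.le_induction with
  | base => rw [S.trans_self_apply, S'.trans_self_apply]
  | succ l h ih =>
    rw [← S'.trans_trans (Z.hm.monotone h) (Z.hm.monotone (Nat.le_succ l)), ← Z.φψ_apply,
      Z.ψφ_apply, ih, S.trans_trans]

/-- The map between the limits induced by the forward maps of a zigzag. -/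
noncomputable def forward (x : S.starLimit) : S'.starLimit :=
  DirectLimit.lift S.trans
    -- Stage `k` enters the subsystem at `n k`, because a strictly increasing sequence satisfies `k
    -- ≤ n k`.
    (fun k a => S'.toLimit (Z.m k) (Z.φ k (S.trans k (Z.n k) (Z.hn.le_apply) a)))
    (fun i j h a => by
      rw [S.trans_trans h, ← S.trans_trans (Z.hn.le_apply) (Z.hn.monotone h), Z.φ_trans h,
        S'.toLimit_trans]) x

/-- The map between the limits induced by the backward maps of a zigzag. -/
noncomputable def backward (x : S'.starLimit) : S.starLimit :=
  DirectLimit.lift S'.trans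
    (fun k a => S.toLimit (Z.n (k + 1)) (Z.ψ k (S'.trans k (Z.m k) (Z.hm.le_apply) a)))
    (fun i j h a => by
      rw [S'.trans_trans h, ← S'.trans_trans (Z.hm.le_apply) (Z.hm.monotone h), Z.ψ_trans h,
        S.toLimit_trans]) x

theorem forward_toLimit (k : ℕ) (a : Mat (S.dim k)) :
    Z.forward (S.toLimit k a) =
      S'.toLimit (Z.m k) (Z.φ k (S.trans k (Z.n k) (Z.hn.le_apply) a)) := rfl

theorem backward_toLimit (k : ℕ) (a : Mat (S'.dim k)) :
    Z.backward (S'.toLimit k a) =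
      S.toLimit (Z.n (k + 1)) (Z.ψ k (S'.trans k (Z.m k) (Z.hm.le_apply) a)) := rfl

theorem forward_toLimit_n (k : ℕ) (a : Mat (S.dim (Z.n k))) :
    Z.forward (S.toLimit (Z.n k) a) = S'.toLimit (Z.m k) (Z.φ k a) := by
  rw [forward_toLimit, Z.φ_trans (Z.hn.le_apply), S'.toLimit_trans]

theorem backward_toLimit_m (k : ℕ) (a : Mat (S'.dim (Z.m k))) :
    Z.backward (S'.toLimit (Z.m k) a) = S.toLimit (Z.n (k + 1)) (Z.ψ k a) := by
  rw [backward_toLimit, Z.ψ_trans (Z.hm.le_apply), S.toLimit_trans]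

theorem backward_forward (x : S.starLimit) : Z.backward (Z.forward x) = x := by
  obtain ⟨k, a, rfl⟩ := S.exists_toLimit_eq x
  rw [forward_toLimit, backward_toLimit_m, ψφ_apply, S.toLimit_trans, S.toLimit_trans]

theorem forward_backward (x : S'.starLimit) : Z.forward (Z.backward x) = x := by
  obtain ⟨k, a, rfl⟩ := S'.exists_toLimit_eq x
  rw [backward_toLimit, forward_toLimit_n, φψ_apply, S'.toLimit_trans, S'.toLimit_trans]

theorem exists_toLimit_eq₂ (S : DirectSys) (x y : S.starLimit) :
    ∃ k a b, S.toLimit k a = x ∧ S.toLimit k b = y := by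
  obtain ⟨k, a, b, rfl, rfl⟩ := DirectLimit.exists_eq_mk₂ S.trans x y
  exact ⟨k, a, b, rfl, rfl⟩

/-- The star isomorphism between the limits induced by a zigzag. -/
noncomputable def starEquiv : S.starLimit ≃⋆ₐ[ℂ] S'.starLimit where
  toFun := Z.forward
  invFun := Z.backward
  left_inv := Z.backward_forward
  right_inv := Z.forward_backward
  map_mul' x y := by
    obtain ⟨k, a, b, rfl, rfl⟩ := exists_toLimit_eq₂ S x y
    simp only [← map_mul, forward_toLimit]
  map_add' x y := by
    obtain ⟨k, a, b, rfl, rfl⟩ := exists_toLimit_eq₂ S x y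
    simp only [← map_add, forward_toLimit]
  map_star' x := by
    obtain ⟨k, a, rfl⟩ := S.exists_toLimit_eq x
    simp only [← map_star, forward_toLimit]
  map_smul' c x := by
    obtain ⟨k, a, rfl⟩ := S.exists_toLimit_eq x
    simp only [← map_smul, forward_toLimit]

theorem forward_mem {x : S.starLimit} (hx : x ∈ S.limit) : Z.forward x ∈ S'.limit := by
  obtain ⟨k, a, ha, rfl⟩ := S.mem_limit.1 hx
  rw [forward_toLimit]
  exact S'.toLimit_mem_limit ((Z.hφ k).2 _ (S.trans_mem _ ha))

theorem backward_mem {x : S'.starLimit} (hx : x ∈ S'.limit) : Z.backward x ∈ S.limit := by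
  obtain ⟨k, a, ha, rfl⟩ := S'.mem_limit.1 hx
  rw [backward_toLimit]
  exact S.toLimit_mem_limit ((Z.hψ k).2 _ (S'.trans_mem _ ha))

/-- The isomorphism between the limit algebras induced by a zigzag. -/
noncomputable def limitHom : S.limit →ₙₐ[ℂ] S'.limit where
  toFun x := ⟨Z.starEquiv x, Z.forward_mem x.2⟩
  map_smul' c x := Subtype.ext (map_smul Z.starEquiv c (x : S.starLimit))
  map_zero' := Subtype.ext (map_zero Z.starEquiv)
  map_add' x y := Subtype.ext (map_add Z.starEquiv (x : S.starLimit) y)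
  map_mul' x y := Subtype.ext (map_mul Z.starEquiv (x : S.starLimit) y)

theorem starExtendiblyIsomorphic {S S' : DirectSys} (Z : Zigzag S S') :
    StarExtendiblyIsomorphic S S' := by
  refine ⟨Z.limitHom, ⟨fun x y h => ?_, fun y => ?_⟩, Z.starEquiv, fun _ => rfl⟩
  · exact Subtype.ext (EquivLike.injective Z.starEquiv (congrArg Subtype.val h))
  · exact ⟨⟨Z.backward y, Z.backward_mem y.2⟩, Subtype.ext (Z.forward_backward y)⟩

end Zigzag

/-- A star homomorphism between limits which carries the image of the `i`-th limit algebra into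
the other limit algebra lifts to a star extendible embedding at every sufficiently late stage. -/
theorem exists_lift {S S' : DirectSys} (Φ : S.starLimit ≃⋆ₐ[ℂ] S'.starLimit)
    (hΦ : ∀ x ∈ S.limit, Φ x ∈ S'.limit) (i : ℕ) :
    ∃ j, i < j ∧ ∃ φ : Mat (S.dim i) →⋆ₙₐ[ℂ] Mat (S'.dim j), IsStarExtEmbedding φ ∧
      ∀ a, S'.toLimit j (φ a) = Φ (S.toLimit i a) := by
  classical
  have h1 : ∀ p q : Idx (S.dim i), ∃ k, ∀ j, k ≤ j → ∃ a : Mat (S'.dim j),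
      S'.toLimit j a = Φ (S.toLimit i (Matrix.single p q 1)) ∧
      (Edge p.1 q.1 → a ∈ algebra (S'.dim j)) := by
    intro p q
    by_cases h : Edge p.1 q.1
    · have hs : Matrix.single p q (1 : ℂ) ∈ algebra (S.dim i) := by
        intro p' q' h'
        rw [Matrix.single_apply, if_neg]
        rintro ⟨rfl, rfl⟩
        exact h' h
      obtain ⟨k, hk⟩ := S'.exists_algebra_toLimit_eq (hΦ _ (S.toLimit_mem_limit hs))
      refine ⟨k, fun j hj => ?_⟩
      obtain ⟨a, ha, h⟩ := hk j hj
      exact ⟨a, h, fun _ => ha⟩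
    · obtain ⟨k, hk⟩ := S'.exists_toLimit_eq_of_le (Φ (S.toLimit i (Matrix.single p q 1)))
      refine ⟨k, fun j hj => ?_⟩
      obtain ⟨a, ha⟩ := hk j hj
      exact ⟨a, ha, fun h' => absurd h' h⟩
  choose k hk using h1
  -- There are finitely many matrix units, so one stage serves them all; `i + 1` makes the indices
  -- of the zigzag strictly increase.
  let j := max (i + 1) (Finset.univ.sup fun p => Finset.univ.sup fun q => k p q)
  have hj : ∀ p q, k p q ≤ j := fun p q =>
    ((Finset.le_sup (f := fun q => k p q) (Finset.mem_univ q)).trans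
      (Finset.le_sup (f := fun p => Finset.univ.sup fun q => k p q) (Finset.mem_univ p))).trans
      (le_max_right _ _)
  choose a ha ha' using fun p q => hk p q j (hj p q)
  let f : Mat (S.dim i) → Mat (S'.dim j) := fun x => ∑ p, ∑ q, x p q • a p q
  have hf : ∀ x, S'.toLimit j (f x) = Φ (S.toLimit i x) := by
    intro x
    conv_rhs => rw [Matrix.matrix_eq_sum_single x]
    simp only [f, map_sum, map_smul, ha]
    refine Finset.sum_congr rfl fun p _ => Finset.sum_congr rfl fun q _ => ?_
    rw [← map_smul, ← map_smul, Matrix.smul_single, smul_eq_mul, mul_one]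
  -- All algebraic identities for `f` hold in the limit, where `f` becomes `Φ`, and descend to stage
  -- `j` by injectivity.
  have inj := S'.toLimit_injective j
  refine ⟨j, (Nat.lt_succ_self i).trans_le (le_max_left _ _), {
    toFun := f
    map_smul' := fun c x => inj ?_
    map_zero' := inj ?_
    map_add' := fun x y => inj ?_
    map_mul' := fun x y => inj ?_
    map_star' := fun x => inj ?_ }, ⟨?_, ?_⟩, hf⟩
  · simp only [MonoidHom.id_apply, map_smul, hf]
  · simp only [map_zero, hf]
  · simp only [map_add, hf]
  · simp only [map_mul, hf]
  · simp only [map_star, hf]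
  · intro x y hxy
    have h : Φ (S.toLimit i x) = Φ (S.toLimit i y) := by
      rw [← hf, ← hf]
      exact congrArg _ hxy
    exact S.toLimit_injective i (EquivLike.injective Φ h)
  · intro x hx
    change f x ∈ algebra (S'.dim j)
    refine sum_mem fun p _ => sum_mem fun q _ => ?_
    by_cases h : Edge p.1 q.1
    · exact Subalgebra.smul_mem _ (ha' p q h) _
    · rw [hx p q h, zero_smul]
      exact zero_mem _

/-- Lifts of `Φ` and of its inverse are taken alternately; the triangles commute because they do so
in the limit, into which every stage embeds. Surjectivity of `θ` is what makes the inverse preserve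
the limit algebras. -/
theorem StarExtendiblyIsomorphic.exists_zigzag {S S' : DirectSys}
    (h : StarExtendiblyIsomorphic S S') : Nonempty (Zigzag S S') := by
  obtain ⟨θ, hθ, Φ, hΦ⟩ := h
  have h1 : ∀ x ∈ S.limit, Φ x ∈ S'.limit := fun x hx => by
    rw [hΦ ⟨x, hx⟩]; exact (θ ⟨x, hx⟩).2
  have h2 : ∀ y ∈ S'.limit, Φ.symm y ∈ S.limit := fun y hy => by
    obtain ⟨x, hx⟩ := hθ.2 ⟨y, hy⟩
    have : Φ x = y := by rw [hΦ, hx]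
    rw [← this, StarAlgEquiv.symm_apply_apply]
    exact x.2
  choose f hf φ hφ hφ' using exists_lift Φ h1
  choose g hg ψ hψ hψ' using exists_lift Φ.symm h2
  let n : ℕ → ℕ := fun k => Nat.rec 0 (fun _ x => g (f x)) k
  have hn : StrictMono n := strictMono_nat_of_lt_succ fun k => (hf (n k)).trans (hg (f (n k)))
  have hm : StrictMono fun k => f (n k) :=
    strictMono_nat_of_lt_succ fun k => (hg (f (n k))).trans (hf (n (k + 1)))
  exact ⟨{
    n := n
    m := fun k => f (n k)
    hn := hn
    hm := hm
    φ := fun k => φ (n k)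
    ψ := fun k => ψ (f (n k))
    hφ := fun k => hφ (n k)
    hψ := fun k => hψ (f (n k))
    ψφ := fun k => NonUnitalStarAlgHom.ext fun a => by
      refine S.toLimit_injective _ ?_
      rw [S.toLimit_trans]
      exact (hψ' _ _).trans ((congrArg Φ.symm (hφ' _ _)).trans (Φ.symm_apply_apply _))
    φψ := fun k => NonUnitalStarAlgHom.ext fun a => by
      refine S'.toLimit_injective _ ?_
      rw [S'.toLimit_trans]
      exact (hφ' _ _).trans ((congrArg Φ (hψ' _ _)).trans (Φ.apply_symm_apply _)) }⟩

/-! ### Projections, commutants and intertwiners in matrix algebras -/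

section MatrixAlgebra

open Matrix
open scoped ComplexOrder

variable {ι κ : Type*} [Fintype ι] [DecidableEq ι] [Fintype κ] [DecidableEq κ]

theorem sum_single_diag : ∑ p : ι, single p p (1 : ℂ) = 1 := by
  rw [← Matrix.diagonal_one, ← Matrix.sum_single_eq_diagonal]

/-- A star projection in a complex matrix algebra factors through an isometry. -/
theorem exists_isometry_of_isStarProjection {P : Matrix ι ι ℂ} (hP : IsStarProjection P) :
    ∃ (k : ℕ) (W : Matrix ι (Fin k) ℂ), (k : ℂ) = P.trace ∧ Wᴴ * W = 1 ∧ W * Wᴴ = P := by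
  have hA : P.IsHermitian := hP.isSelfAdjoint
  set U : Matrix ι ι ℂ := hA.eigenvectorUnitary.1 with hU
  have hUU : Uᴴ * U = 1 := Unitary.coe_star_mul_self hA.eigenvectorUnitary
  set D : Matrix ι ι ℂ := diagonal fun i => (hA.eigenvalues i : ℂ) with hD
  have hPU : P = U * D * Uᴴ := by
    conv_lhs => rw [hA.spectral_theorem]
    rfl
  have hDU : D = Uᴴ * P * U := by
    rw [hPU]
    simp only [← mul_assoc, hUU, one_mul]
    rw [mul_assoc, hUU, mul_one]
  have hDD : D * D = D := by
    have hUU' : U * Uᴴ = 1 := mul_eq_one_comm.1 hUU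
    calc D * D = Uᴴ * P * (U * Uᴴ) * P * U := by rw [hDU]; simp only [mul_assoc]
      _ = Uᴴ * (P * P) * U := by rw [hUU', mul_one]; simp only [mul_assoc]
      _ = D := by rw [hP.isIdempotentElem.eq, hDU]
  have h01 : ∀ i, (hA.eigenvalues i : ℂ) = if hA.eigenvalues i = 1 then 1 else 0 := by
    intro i
    have h := congrFun (congrFun hDD i) i
    simp only [hD, diagonal_mul_diagonal, diagonal_apply_eq] at h
    split_ifs with h1
    · simp [h1]
    · have h2 : (hA.eigenvalues i : ℂ) ≠ 1 := by exact_mod_cast h1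
      by_contra h3
      exact h2 (mul_left_cancel₀ h3 (by rw [h, mul_one]))
  let e : Fin (Fintype.card {i // hA.eigenvalues i = 1}) ≃ {i // hA.eigenvalues i = 1} :=
    (Fintype.equivFin _).symm
  have hsum : ∀ f : ι → ℂ, ∑ t, f (e t) = ∑ i, (hA.eigenvalues i : ℂ) * f i := by
    intro f
    rw [Equiv.sum_comp e (fun i => f i), ← Finset.sum_subtype
      (Finset.univ.filter fun i => hA.eigenvalues i = 1) (by simp) f, Finset.sum_filter]
    refine Finset.sum_congr rfl fun i _ => ?_
    rw [h01 i, ite_mul, one_mul, zero_mul]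
  -- The columns of the isometry are the eigenvectors for the eigenvalue one.
  refine ⟨_, U.submatrix id (fun t => (e t : ι)), ?_, ?_, ?_⟩
  · rw [hA.trace_eq_sum_eigenvalues]
    have := hsum fun _ => 1
    simpa using this
  · have h : (U.submatrix id (fun t => (e t : ι)))ᴴ * U.submatrix id (fun t => (e t : ι)) =
        (Uᴴ * U).submatrix (fun t => (e t : ι)) (fun t => (e t : ι)) := rfl
    rw [h, hUU]
    exact submatrix_one _ (Subtype.val_injective.comp e.injective)
  · ext r s
    have h := hsum fun i => U r i * star (U s i)
    have h' : P r s = (U * D * Uᴴ) r s := congrFun (congrFun hPU r) s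
    rw [h', mul_apply, mul_apply]
    simp only [submatrix_apply, conjTranspose_apply, id, hD, mul_diagonal]
    rw [h]
    exact Finset.sum_congr rfl fun i _ => by ring

/-- The Gram matrix of the defect `w * P - w` expands to `P - P - P + P = 0`. -/
theorem mul_eq_self_of_conjTranspose_mul {w P : Matrix ι ι ℂ} (hP : IsStarProjection P)
    (hw : wᴴ * w = P) : w * P = w := by
  have h : (w * P - w)ᴴ * (w * P - w) = 0 := by
    have hs : Pᴴ = P := hP.isSelfAdjoint
    have hi := hP.isIdempotentElem.eq
    rw [conjTranspose_sub, conjTranspose_mul, hs]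
    calc (P * wᴴ - wᴴ) * (w * P - w)
        = P * (wᴴ * w) * P - P * (wᴴ * w) - (wᴴ * w) * P + wᴴ * w := by noncomm_ring
      _ = 0 := by simp only [hw, hi]; abel
  exact sub_eq_zero.1 (conjTranspose_mul_self_eq_zero.1 h)

/-- Two families of mutually orthogonal star projections with equal traces are intertwined by a
partial isometry. -/
theorem exists_partialIsometry {τ : Type*} [Fintype τ] [DecidableEq τ] {P Q : τ → Matrix ι ι ℂ}
    (hP : ∀ i, IsStarProjection (P i)) (hQ : ∀ i, IsStarProjection (Q i))
    (hPP : ∀ i j, i ≠ j → P i * P j = 0) (hQQ : ∀ i j, i ≠ j → Q i * Q j = 0)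
    (htr : ∀ i, (P i).trace = (Q i).trace) :
    ∃ w : Matrix ι ι ℂ, wᴴ * w = ∑ i, P i ∧ w * wᴴ = ∑ i, Q i ∧ ∀ i, w * P i = Q i * w := by
  have h1 : ∀ i, ∃ w : Matrix ι ι ℂ, wᴴ * w = P i ∧ w * wᴴ = Q i := by
    intro i
    obtain ⟨k, W, hk, hW, hW'⟩ := exists_isometry_of_isStarProjection (hP i)
    obtain ⟨l, X, hl, hX, hX'⟩ := exists_isometry_of_isStarProjection (hQ i)
    -- The trace of a projection is its rank, so both projections factor through the same space and
    -- `X * Wᴴ` makes sense.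
    obtain rfl : k = l := by
      have := hk.trans ((htr i).trans hl.symm)
      exact_mod_cast this
    refine ⟨X * Wᴴ, ?_, ?_⟩
    · rw [conjTranspose_mul, conjTranspose_conjTranspose, ← hW']
      calc W * Xᴴ * (X * Wᴴ) = W * (Xᴴ * X) * Wᴴ := by simp only [Matrix.mul_assoc]
        _ = W * Wᴴ := by rw [hX, Matrix.mul_one]
    · rw [conjTranspose_mul, conjTranspose_conjTranspose, ← hX']
      calc X * Wᴴ * (W * Xᴴ) = X * (Wᴴ * W) * Xᴴ := by simp only [Matrix.mul_assoc]
        _ = X * Xᴴ := by rw [hW, Matrix.mul_one]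
  choose w hw hw' using h1
  have hwP : ∀ i, w i * P i = w i := fun i =>
    mul_eq_self_of_conjTranspose_mul (hP i) (hw i)
  have hQw : ∀ i, Q i * w i = w i := by
    intro i
    rw [← hw', mul_assoc, hw, hwP]
  have hPw : ∀ i, P i * (w i)ᴴ = (w i)ᴴ := by
    intro i
    have hPs : (P i)ᴴ = P i := (hP i).isSelfAdjoint
    have := congrArg conjTranspose (hwP i)
    rwa [conjTranspose_mul, hPs] at this
  have hwQ : ∀ i, (w i)ᴴ * Q i = (w i)ᴴ := by
    intro i
    have hQs : (Q i)ᴴ = Q i := (hQ i).isSelfAdjoint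
    have := congrArg conjTranspose (hQw i)
    rwa [conjTranspose_mul, hQs] at this
  refine ⟨∑ i, w i, ?_, ?_, ?_⟩
  · rw [conjTranspose_sum, Finset.sum_mul_sum]
    refine Finset.sum_congr rfl fun i _ => ?_
    rw [Finset.sum_eq_single i, hw]
    · intro j _ hj
      rw [← hwQ i, ← hQw j, mul_assoc, ← mul_assoc (Q i), hQQ i j hj.symm, zero_mul, mul_zero]
    · simp
  · rw [conjTranspose_sum, Finset.sum_mul_sum]
    refine Finset.sum_congr rfl fun i _ => ?_
    rw [Finset.sum_eq_single i, hw']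
    · intro j _ hj
      rw [← hwP i, ← hPw j, mul_assoc, ← mul_assoc (P i), hPP i j hj.symm, zero_mul, mul_zero]
    · simp
  · intro i
    rw [Finset.sum_mul, Finset.mul_sum, Finset.sum_eq_single i, Finset.sum_eq_single i, hwP, hQw]
    · intro j _ hj
      rw [← hQw j, ← mul_assoc, hQQ i j hj.symm, zero_mul]
    · simp
    · intro j _ hj
      rw [← hwP j, mul_assoc, hPP j i hj, mul_zero]
    · simp

section StarHom

variable (φ : Matrix ι ι ℂ →⋆ₙₐ[ℂ] Matrix κ κ ℂ)

theorem map_conjTranspose' (x : Matrix ι ι ℂ) : φ xᴴ = (φ x)ᴴ := map_star φ x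

theorem map_mul_map_one (x : Matrix ι ι ℂ) : φ x * φ 1 = φ x := by rw [← map_mul, mul_one]

theorem map_one_mul_map (x : Matrix ι ι ℂ) : φ 1 * φ x = φ x := by rw [← map_mul, one_mul]

variable {φ}

/-- Matrix multiplication is injective on the tensor product of the range of a star homomorphism
and its commutant: a product determines the entries of the first factor. -/
theorem sum_map_single_mul_map_single {y : Matrix κ κ ℂ} (hy : ∀ x, Commute (φ x) y)
    (x : Matrix ι ι ℂ) (q r : ι) :
    ∑ p, φ (single p q 1) * (φ x * y) * φ (single r p 1) = x q r • (φ 1 * y) := by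
  have h : ∀ p, φ (single p q 1) * (φ x * y) * φ (single r p 1) =
      x q r • (φ (single p p 1) * y) := by
    intro p
    rw [mul_assoc, mul_assoc, ← (hy _).eq, ← mul_assoc, ← mul_assoc, ← map_mul, ← map_mul,
      single_mul_mul_single, ← smul_mul_assoc, ← map_smul, smul_single]
    simp
  rw [Finset.sum_congr rfl fun p _ => h p, ← Finset.smul_sum, ← Finset.sum_mul, ← map_sum,
    sum_single_diag]

/-- Comparison of coefficients: one equation between products of a range element and a commutant
element becomes a family of scalar relations between the commutant elements. The dichotomies for
signs of factors rest on it. -/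
theorem smul_eq_smul_of_map_mul_eq {y₁ y₂ : Matrix κ κ ℂ} (h₁ : ∀ x, Commute (φ x) y₁)
    (h₂ : ∀ x, Commute (φ x) y₂) {x₁ x₂ : Matrix ι ι ℂ} (h : φ x₁ * y₁ = φ x₂ * y₂) (q r : ι) :
    x₁ q r • (φ 1 * y₁) = x₂ q r • (φ 1 * y₂) := by
  rw [← sum_map_single_mul_map_single h₁, ← sum_map_single_mul_map_single h₂, h]

theorem map_one_mul_eq_zero {y : Matrix κ κ ℂ} (hy : ∀ x, Commute (φ x) y) {x : Matrix ι ι ℂ}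
    (hx : x ≠ 0) (h : φ x * y = 0) : φ 1 * y = 0 := by
  obtain ⟨q, r, hqr⟩ : ∃ q r, x q r ≠ 0 := by
    by_contra! h'
    exact hx (Matrix.ext h')
  have h' := sum_map_single_mul_map_single hy x q r
  simp only [h, mul_zero, zero_mul, Finset.sum_const_zero] at h'
  exact (smul_eq_zero.1 h'.symm).resolve_left hqr

/-- For `y` in the commutant, `x ↦ tr (φ x * y)` is a tracial functional on a full matrix algebra,
hence a multiple of the trace. -/
theorem trace_map_mul_eq_of_trace_eq {y : Matrix κ κ ℂ} (hy : ∀ x, Commute (φ x) y)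
    {x₁ x₂ : Matrix ι ι ℂ} (h : x₁.trace = x₂.trace) :
    (φ x₁ * y).trace = (φ x₂ * y).trace := by
  rcases isEmpty_or_nonempty ι with hι | ⟨⟨o⟩⟩
  · rw [Subsingleton.elim x₁ x₂]
  · have key : ∀ x : Matrix ι ι ℂ, (φ x * y).trace = x.trace * (φ (single o o 1) * y).trace := by
      intro x
      have hpq : ∀ p q : ι, (φ (single p q 1) * y).trace =
          if p = q then (φ (single o o 1) * y).trace else 0 := by
        intro p q
        have h1 : single p q (1 : ℂ) = single p o 1 * single o q 1 := by
          rw [single_mul_single_same, one_mul]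
        rw [h1, map_mul, mul_assoc, trace_mul_comm, mul_assoc, ← (hy _).eq, ← mul_assoc,
          ← map_mul]
        split_ifs with hpq
        · rw [hpq, single_mul_single_same, one_mul]
        · rw [single_mul_single_of_ne _ _ _ _ (Ne.symm hpq), map_zero, zero_mul, trace_zero]
      conv_lhs => rw [matrix_eq_sum_single x]
      simp only [map_sum, Finset.sum_mul, trace_sum]
      have h2 : ∀ p q, (φ (single p q (x p q)) * y).trace =
          if p = q then x p q * (φ (single o o 1) * y).trace else 0 := by
        intro p q
        have h3 : single p q (x p q) = x p q • single p q (1 : ℂ) := by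
          rw [smul_single, smul_eq_mul, mul_one]
        rw [h3, map_smul, smul_mul_assoc, trace_smul, hpq, smul_eq_mul, mul_ite, mul_zero]
      simp only [h2, Finset.sum_ite_eq, Finset.mem_univ, if_true]
      rw [← Finset.sum_mul]
      rfl
    rw [key x₁, key x₂, h]

theorem trace_map_eq_of_trace_eq {x₁ x₂ : Matrix ι ι ℂ} (h : x₁.trace = x₂.trace) :
    (φ x₁).trace = (φ x₂).trace := by
  simpa using trace_map_mul_eq_of_trace_eq (φ := φ) (fun x => Commute.one_right (φ x)) h

theorem trace_map_mul_eq_zero {y : Matrix κ κ ℂ} (hy : ∀ x, Commute (φ x) y)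
    {x : Matrix ι ι ℂ} (h : x.trace = 0) : (φ x * y).trace = 0 := by
  rw [trace_map_mul_eq_of_trace_eq hy (x₂ := 0) (by rw [h, trace_zero]), map_zero, zero_mul,
    trace_zero]

theorem single_mul_eq_sum (o p : ι) (x : Matrix ι ι ℂ) :
    single o p 1 * x = ∑ q, x p q • single o q (1 : ℂ) := by
  ext r s
  rw [Matrix.sum_apply]
  by_cases h : r = o
  · subst h
    simp [single_apply]
  · rw [single_mul_apply_of_ne (h := h)]
    simp [Ne.symm h]

theorem mul_single_eq_sum (q o : ι) (x : Matrix ι ι ℂ) :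
    x * single q o 1 = ∑ p, x p q • single p o (1 : ℂ) := by
  ext r s
  rw [Matrix.sum_apply]
  by_cases h : s = o
  · subst h
    simp [single_apply]
  · rw [mul_single_apply_of_ne (hbj := h)]
    simp [Ne.symm h]

/-- A matrix which intertwines two star homomorphisms. -/
def intertwiner (α β : Matrix ι ι ℂ →⋆ₙₐ[ℂ] Matrix κ κ ℂ) (o : ι) (w : Matrix κ κ ℂ) :
    Matrix κ κ ℂ := ∑ p, β (single p o 1) * w * α (single o p 1)

section Intertwiner

variable {α β : Matrix ι ι ℂ →⋆ₙₐ[ℂ] Matrix κ κ ℂ} {o : ι} {w : Matrix κ κ ℂ}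

/-- Any `w`, read as a map from the corner `α (e_oo)` to the corner `β (e_oo)`, is spread by matrix
units over the whole of both ranges; expanding in the entries `x p q` gives the same double sum on
either side. -/
theorem intertwiner_mul (x : Matrix ι ι ℂ) :
    intertwiner α β o w * α x = β x * intertwiner α β o w := by
  rw [intertwiner, Finset.sum_mul, Finset.mul_sum]
  have h1 : ∀ p, β (single p o 1) * w * α (single o p 1) * α x =
      ∑ q, x p q • (β (single p o 1) * w * α (single o q 1)) := by
    intro p
    rw [mul_assoc, ← map_mul, single_mul_eq_sum, map_sum, Finset.mul_sum]
    simp only [map_smul, mul_smul_comm]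
  have h2 : ∀ q, β x * (β (single q o 1) * w * α (single o q 1)) =
      ∑ p, x p q • (β (single p o 1) * w * α (single o q 1)) := by
    intro q
    rw [← mul_assoc, ← mul_assoc, ← map_mul, mul_single_eq_sum, map_sum, Finset.sum_mul,
      Finset.sum_mul]
    simp only [map_smul, smul_mul_assoc]
  simp only [h1, h2]
  exact Finset.sum_comm

theorem conjTranspose_intertwiner :
    (intertwiner α β o w)ᴴ = intertwiner β α o wᴴ := by
  rw [intertwiner, intertwiner, conjTranspose_sum]
  refine Finset.sum_congr rfl fun p _ => ?_
  rw [conjTranspose_mul, conjTranspose_mul, ← map_conjTranspose', ← map_conjTranspose',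
    conjTranspose_single, conjTranspose_single, star_one, mul_assoc]

theorem map_single_mul_intertwiner (p : ι) :
    β (single o p 1) * intertwiner α β o w = β (single o o 1) * w * α (single o p 1) := by
  rw [intertwiner, Finset.mul_sum, Finset.sum_eq_single p, ← mul_assoc, ← mul_assoc, ← map_mul,
    single_mul_single_same, one_mul]
  · intro q _ hq
    rw [← mul_assoc, ← mul_assoc, ← map_mul, single_mul_single_of_ne _ _ _ _ hq.symm, map_zero,
      zero_mul, zero_mul]
  · simp

theorem conjTranspose_intertwiner_mul (h1 : wᴴ * w = α (single o o 1))
    (h2 : β (single o o 1) * w = w) :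
    (intertwiner α β o w)ᴴ * intertwiner α β o w = α 1 := by
  rw [conjTranspose_intertwiner]
  conv_lhs => enter [1]; rw [intertwiner]
  rw [Finset.sum_mul, ← sum_single_diag, map_sum]
  refine Finset.sum_congr rfl fun p _ => ?_
  rw [mul_assoc, map_single_mul_intertwiner, h2, mul_assoc, ← mul_assoc wᴴ, h1, ← map_mul,
    ← map_mul, single_mul_single_same, single_mul_single_same]
  simp

end Intertwiner

/-- The star homomorphism `x ↦ d (φ x) dᴴ`, for an element `d` which is isometric on the range
of `φ`. -/
def conjHom (φ : Matrix ι ι ℂ →⋆ₙₐ[ℂ] Matrix κ κ ℂ) (d : Matrix κ κ ℂ)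
    (hd : ∀ x, dᴴ * d * φ x = φ x) : Matrix ι ι ℂ →⋆ₙₐ[ℂ] Matrix κ κ ℂ where
  toFun x := d * φ x * dᴴ
  map_smul' c x := by simp
  map_zero' := by simp
  map_add' x y := by rw [map_add, mul_add, add_mul]
  map_mul' x y := by
    rw [map_mul]
    calc d * (φ x * φ y) * dᴴ = d * (φ x * (dᴴ * d * φ y)) * dᴴ := by rw [hd]
      _ = d * φ x * dᴴ * (d * φ y * dᴴ) := by simp only [mul_assoc]
  map_star' x := by
    rw [map_star, star_eq_conjTranspose, star_eq_conjTranspose, conjTranspose_mul,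
      conjTranspose_mul, conjTranspose_conjTranspose, mul_assoc]

theorem conjHom_apply (d : Matrix κ κ ℂ) (hd : ∀ x, dᴴ * d * φ x = φ x) (x : Matrix ι ι ℂ) :
    conjHom φ d hd x = d * φ x * dᴴ := rfl

theorem trace_conjHom (d : Matrix κ κ ℂ) (hd : ∀ x, dᴴ * d * φ x = φ x) (x : Matrix ι ι ℂ) :
    (conjHom φ d hd x).trace = (φ x).trace := by
  rw [conjHom_apply, trace_mul_comm, ← mul_assoc, hd]

theorem conjHom_injective (hφ : Function.Injective φ) (d : Matrix κ κ ℂ)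
    (hd : ∀ x, dᴴ * d * φ x = φ x) : Function.Injective (conjHom φ d hd) := by
  intro x y h
  have key : ∀ x, dᴴ * conjHom φ d hd x * d = φ x := by
    intro x
    have h1 := congrArg conjTranspose (hd xᴴ)
    simp only [conjTranspose_mul, map_conjTranspose', conjTranspose_conjTranspose] at h1
    rw [conjHom_apply]
    calc dᴴ * (d * φ x * dᴴ) * d = dᴴ * d * φ x * (dᴴ * d) := by simp only [mul_assoc]
      _ = φ x := by rw [hd, h1]
  exact hφ (by rw [← key x, ← key y, h])

/-- The star homomorphism `x ↦ V x Vᴴ` defined by an isometry `V`. -/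
def isometryHom (V : Matrix κ ι ℂ) (hV : Vᴴ * V = 1) :
    Matrix ι ι ℂ →⋆ₙₐ[ℂ] Matrix κ κ ℂ where
  toFun x := V * x * Vᴴ
  map_smul' c x := by simp
  map_zero' := by simp
  map_add' x y := by rw [Matrix.mul_add, Matrix.add_mul]
  map_mul' x y := by
    calc V * (x * y) * Vᴴ = V * (x * ((Vᴴ * V) * y)) * Vᴴ := by rw [hV, one_mul]
      _ = V * x * Vᴴ * (V * y * Vᴴ) := by simp only [Matrix.mul_assoc]
  map_star' x := by
    rw [star_eq_conjTranspose, star_eq_conjTranspose, conjTranspose_mul,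
      conjTranspose_mul, conjTranspose_conjTranspose, Matrix.mul_assoc]

theorem isometryHom_apply (V : Matrix κ ι ℂ) (hV : Vᴴ * V = 1) (x : Matrix ι ι ℂ) :
    isometryHom V hV x = V * x * Vᴴ := rfl

theorem conjTranspose_mul_isometryHom_mul (V : Matrix κ ι ℂ) (hV : Vᴴ * V = 1)
    (x : Matrix ι ι ℂ) : Vᴴ * isometryHom V hV x * V = x := by
  rw [isometryHom_apply]
  calc Vᴴ * (V * x * Vᴴ) * V = (Vᴴ * V) * x * (Vᴴ * V) := by simp only [Matrix.mul_assoc]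
    _ = x := by rw [hV, one_mul, mul_one]

theorem isometryHom_injective (V : Matrix κ ι ℂ) (hV : Vᴴ * V = 1) :
    Function.Injective (isometryHom V hV) := by
  intro x y h
  rw [← conjTranspose_mul_isometryHom_mul V hV x, h, conjTranspose_mul_isometryHom_mul]

theorem rank_isometryHom (V : Matrix κ ι ℂ) (hV : Vᴴ * V = 1) (x : Matrix ι ι ℂ) :
    (isometryHom V hV x).rank = x.rank := by
  apply le_antisymm
  · rw [isometryHom_apply]
    exact (rank_mul_le_left _ _).trans (rank_mul_le_right _ _)
  · conv_lhs => rw [← conjTranspose_mul_isometryHom_mul V hV x]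
    exact (rank_mul_le_left _ _).trans (rank_mul_le_right _ _)

end StarHom

end MatrixAlgebra

/-! ### Block weights and sign symmetries -/

open Matrix

/-- The matrix which is the scalar `w i` on the `i`-th diagonal block. -/
def wt (n : Fin 4 → ℕ) (w : Fin 4 → ℂ) : Mat n := diagonal fun p => w p.1

section Weights

variable {n : Fin 4 → ℕ}

theorem wt_mul_wt (w w' : Fin 4 → ℂ) : wt n w * wt n w' = wt n (w * w') :=
  diagonal_mul_diagonal _ _

theorem wt_add (w w' : Fin 4 → ℂ) : wt n (w + w') = wt n w + wt n w' :=
  (diagonal_add _ _).symm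

theorem wt_smul (c : ℂ) (w : Fin 4 → ℂ) : wt n (c • w) = c • wt n w :=
  (diagonal_smul c _)

theorem wt_one : wt n 1 = 1 := diagonal_one

theorem wt_zero : wt n 0 = 0 := diagonal_zero

theorem commute_wt_wt (w w' : Fin 4 → ℂ) : Commute (wt n w) (wt n w') := by
  rw [Commute, SemiconjBy, wt_mul_wt, wt_mul_wt, mul_comm]

theorem wt_conjTranspose {w : Fin 4 → ℂ} (hw : star w = w) : (wt n w)ᴴ = wt n w := by
  rw [wt, diagonal_conjTranspose]
  exact congrArg diagonal (funext fun p => congrFun hw p.1)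

theorem wt_mul_apply (w : Fin 4 → ℂ) (a : Mat n) (p q : Idx n) :
    (wt n w * a) p q = w p.1 * a p q := diagonal_mul _ _ _ _

theorem mul_wt_apply (w : Fin 4 → ℂ) (a : Mat n) (p q : Idx n) :
    (a * wt n w) p q = a p q * w q.1 := mul_diagonal _ _ _ _

theorem wt_mul_single (w : Fin 4 → ℂ) (p q : Idx n) :
    wt n w * single p q 1 = w p.1 • single p q (1 : ℂ) := by
  ext r s
  rw [wt_mul_apply, Matrix.smul_apply, smul_eq_mul, single_apply]
  split_ifs with h
  · rw [h.1]
  · simp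

theorem single_mul_wt (w : Fin 4 → ℂ) (p q : Idx n) :
    single p q 1 * wt n w = w q.1 • single p q (1 : ℂ) := by
  ext r s
  rw [mul_wt_apply, Matrix.smul_apply, smul_eq_mul, single_apply]
  split_ifs with h
  · rw [h.2, mul_comm]
  · simp

theorem wt_ne_zero {w : Fin 4 → ℂ} (hn : ∀ i, 0 < n i) {i : Fin 4} (hi : w i ≠ 0) :
    wt n w ≠ 0 := by
  intro h
  have := congrFun (congrFun h ⟨i, ⟨0, hn i⟩⟩) ⟨i, ⟨0, hn i⟩⟩
  rw [wt, diagonal_apply_eq] at this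
  exact hi this

theorem wt_eq_sum (w : Fin 4 → ℂ) : wt n w = ∑ i, w i • wt n (Pi.single i 1) := by
  ext p q
  rw [Matrix.sum_apply]
  simp only [Matrix.smul_apply, smul_eq_mul, wt, diagonal_apply]
  split_ifs with h
  · simp [Pi.single_apply]
  · simp

end Weights

/-- The signs of the first two vertices of `D_4`. -/
def gL : Fin 4 → ℂ := ![1, -1, 0, 0]

/-- The signs of the last two vertices of `D_4`. -/
def gR : Fin 4 → ℂ := ![0, 0, 1, -1]

theorem star_gL : star gL = gL := by ext i; fin_cases i <;> simp [gL]

theorem star_gR : star gR = gR := by ext i; fin_cases i <;> simp [gR]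

theorem gL_mul_gR : gL * gR = 0 := by ext i; fin_cases i <;> simp [gL, gR]

theorem gL_sq_add_gR_sq : gL * gL + gR * gR = 1 := by ext i; fin_cases i <;> simp [gL, gR]

/-- The weights `gL`, `gR` and their squares span all four-tuples. -/
theorem commute_wt_of_signs {n : Fin 4 → ℕ} {x : Mat n} (hL : Commute (wt n gL) x)
    (hR : Commute (wt n gR) x) (w : Fin 4 → ℂ) : Commute (wt n w) x := by
  have h : w = ((w 0 + w 1) / 2) • (gL * gL) + ((w 0 - w 1) / 2) • gL +
      (((w 2 + w 3) / 2) • (gR * gR) + ((w 2 - w 3) / 2) • gR) := by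
    ext i
    simp only [Pi.add_apply, Pi.smul_apply, Pi.mul_apply, smul_eq_mul]
    fin_cases i <;> simp [gL, gR] <;> ring
  rw [h]
  simp only [wt_add, wt_smul, ← wt_mul_wt]
  exact (((hL.mul_left hL).smul_left _).add_left (hL.smul_left _)).add_left
    (((hR.mul_left hR).smul_left _).add_left (hR.smul_left _))

/-- `u` is a symmetry in the commutant of the range of `φ` which records how `φ` acts on the
signs `g`. -/
structure IsSignOf (g : Fin 4 → ℂ) {m n : Fin 4 → ℕ} (φ : Mat m →⋆ₙₐ[ℂ] Mat n) (u : Mat n) :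
    Prop where
  star_eq : uᴴ = u
  comm : ∀ x, Commute (φ x) u
  one_mul : φ 1 * u = u
  sq : u * u = φ 1
  sign : wt n g * φ 1 = u * φ (wt m g)

namespace IsSignOf

variable {g : Fin 4 → ℂ} {m n k : Fin 4 → ℕ} {φ : Mat m →⋆ₙₐ[ℂ] Mat n} {u : Mat n}

theorem wt_mul_map (h : IsSignOf g φ u) (x : Mat m) :
    wt n g * φ x = u * φ (wt m g * x) := by
  rw [← map_one_mul_map φ x, ← mul_assoc, h.sign, mul_assoc, ← map_mul]

theorem map_mul_wt (h : IsSignOf g φ u) (hg : star g = g) (x : Mat m) :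
    φ x * wt n g = φ (x * wt m g) * u := by
  have := congrArg conjTranspose (h.wt_mul_map xᴴ)
  rw [conjTranspose_mul, conjTranspose_mul, wt_conjTranspose hg, h.star_eq,
    ← map_conjTranspose', ← map_conjTranspose', conjTranspose_mul, wt_conjTranspose hg,
    conjTranspose_conjTranspose] at this
  exact this

/-- A commutant element below `φ 1` is determined by its product with a single nonzero element of
the range, here `φ (wt m g)`. -/
theorem eq (h : IsSignOf g φ u) {u' : Mat n} (h' : IsSignOf g φ u') (hg : wt m g ≠ 0) :
    u = u' := by
  have h1 : φ 1 * (u - u') = 0 := by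
    refine map_one_mul_eq_zero (fun x => (h.comm x).sub_right (h'.comm x)) hg ?_
    rw [mul_sub, (h.comm _).eq, (h'.comm _).eq, ← h.sign, ← h'.sign, sub_self]
  rw [mul_sub, h.one_mul, h'.one_mul] at h1
  exact sub_eq_zero.1 h1

/-- Signs multiply under composition: `g` crosses `ψ` at the cost of `x`, then crosses `φ` at the
cost of `ψ u`. -/
theorem comp (h : IsSignOf g φ u) {ψ : Mat n →⋆ₙₐ[ℂ] Mat k} {x : Mat k} (hx : IsSignOf g ψ x) :
    IsSignOf g (ψ.comp φ) (ψ u * x) where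
  star_eq := by
    rw [conjTranspose_mul, hx.star_eq, ← map_conjTranspose', h.star_eq, (hx.comm u).eq]
  comm a := by
    have h1 : Commute (ψ (φ a)) (ψ u) := (h.comm a).map ψ
    exact h1.mul_right (hx.comm _)
  one_mul := by
    change ψ (φ 1) * (ψ u * x) = _
    rw [← mul_assoc, ← map_mul, h.one_mul]
  sq := by
    change _ = ψ (φ 1)
    rw [mul_assoc, ← mul_assoc x, ← (hx.comm u).eq, mul_assoc, hx.sq, ← mul_assoc, ← map_mul,
      h.sq, map_mul_map_one]
  sign := by
    change wt k g * ψ (φ 1) = _ * ψ (φ (wt m g))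
    rw [hx.wt_mul_map, h.sign, map_mul, ← mul_assoc, (hx.comm u).eq]

theorem id : IsSignOf g (NonUnitalStarAlgHom.id ℂ (Mat m)) 1 where
  star_eq := conjTranspose_one
  comm x := Commute.one_right _
  one_mul := by rw [mul_one]; rfl
  sq := by rw [mul_one]; rfl
  sign := by rw [_root_.one_mul]; exact mul_one _

theorem conj (h : IsSignOf g φ u) {U : Mat n} (hU : Uᴴ * U = 1) (hU' : Commute (wt n g) U)
    (hd : ∀ x, Uᴴ * U * φ x = φ x) : IsSignOf g (conjHom φ U hd) (U * u * Uᴴ) where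
  star_eq := by
    rw [conjTranspose_mul, conjTranspose_mul, conjTranspose_conjTranspose, h.star_eq, mul_assoc]
  comm x := by
    rw [conjHom_apply]
    calc U * φ x * Uᴴ * (U * u * Uᴴ) = U * φ x * (Uᴴ * U) * u * Uᴴ := by simp only [mul_assoc]
      _ = U * (φ x * u) * Uᴴ := by rw [hU, mul_one]; simp only [mul_assoc]
      _ = U * u * (Uᴴ * U) * φ x * Uᴴ := by rw [hU, mul_one, (h.comm x).eq]; simp only [mul_assoc]
      _ = U * u * Uᴴ * (U * φ x * Uᴴ) := by simp only [mul_assoc]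
  one_mul := by
    rw [conjHom_apply]
    calc U * φ 1 * Uᴴ * (U * u * Uᴴ) = U * φ 1 * (Uᴴ * U) * u * Uᴴ := by simp only [mul_assoc]
      _ = U * (φ 1 * u) * Uᴴ := by rw [hU, mul_one]; simp only [mul_assoc]
      _ = _ := by rw [h.one_mul]
  sq := by
    rw [conjHom_apply]
    calc U * u * Uᴴ * (U * u * Uᴴ) = U * u * (Uᴴ * U) * u * Uᴴ := by simp only [mul_assoc]
      _ = U * (u * u) * Uᴴ := by rw [hU, mul_one]; simp only [mul_assoc]
      _ = _ := by rw [h.sq]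
  sign := by
    rw [conjHom_apply, conjHom_apply]
    calc wt n g * (U * φ 1 * Uᴴ) = wt n g * U * φ 1 * Uᴴ := by simp only [mul_assoc]
      _ = U * (wt n g * φ 1) * Uᴴ := by rw [hU'.eq]; simp only [mul_assoc]
      _ = U * u * (Uᴴ * U) * φ (wt m g) * Uᴴ := by
        rw [h.sign, hU, mul_one]; simp only [mul_assoc]
      _ = U * u * Uᴴ * (U * φ (wt m g) * Uᴴ) := by simp only [mul_assoc]

end IsSignOf

/-! ### Signs of rigid embeddings -/

section Rigid

variable {m n : Fin 4 → ℕ}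

theorem IsSymmetry.cases {σ : Equiv.Perm (Fin 4)} (hσ : IsSymmetry σ) :
    (σ 0 = 0 ∧ σ 1 = 1 ∨ σ 0 = 1 ∧ σ 1 = 0) ∧ (σ 2 = 2 ∧ σ 3 = 3 ∨ σ 2 = 3 ∧ σ 3 = 2) := by
  revert σ
  unfold IsSymmetry Edge
  decide

/-- A symmetry of `D_4` fixes or exchanges the vertices in each of the pairs `{0, 1}` and `{2, 3}`,
so a type is the same as a pair of signs. -/
theorem IsSymmetry.exists_sign_left {σ : Equiv.Perm (Fin 4)} (hσ : IsSymmetry σ) :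
    ∃ ε : ℂ, star ε = ε ∧ ε * ε = 1 ∧ (gL ∘ σ) = ε • gL := by
  obtain ⟨h1 | h1, h2 | h2⟩ := hσ.cases
  · exact ⟨1, by simp, by simp, by ext i; fin_cases i <;> simp [gL, h1, h2]⟩
  · exact ⟨1, by simp, by simp, by ext i; fin_cases i <;> simp [gL, h1, h2]⟩
  · exact ⟨-1, by simp, by simp, by ext i; fin_cases i <;> simp [gL, h1, h2]⟩
  · exact ⟨-1, by simp, by simp, by ext i; fin_cases i <;> simp [gL, h1, h2]⟩

theorem IsSymmetry.exists_sign_right {σ : Equiv.Perm (Fin 4)} (hσ : IsSymmetry σ) :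
    ∃ ε : ℂ, star ε = ε ∧ ε * ε = 1 ∧ (gR ∘ σ) = ε • gR := by
  obtain ⟨h1 | h1, h2 | h2⟩ := hσ.cases
  · exact ⟨1, by simp, by simp, by ext i; fin_cases i <;> simp [gR, h1, h2]⟩
  · exact ⟨-1, by simp, by simp, by ext i; fin_cases i <;> simp [gR, h1, h2]⟩
  · exact ⟨1, by simp, by simp, by ext i; fin_cases i <;> simp [gR, h1, h2]⟩
  · exact ⟨-1, by simp, by simp, by ext i; fin_cases i <;> simp [gR, h1, h2]⟩

theorem wt_mul_of_mem_block {i j : Fin 4} {a : Mat n} (ha : a ∈ block n i j) (w : Fin 4 → ℂ) :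
    wt n w * a = w i • a := by
  ext p q
  rw [wt_mul_apply, Matrix.smul_apply, smul_eq_mul]
  by_cases h : p.1 = i ∧ q.1 = j
  · rw [h.1]
  · rw [ha p q h, mul_zero, mul_zero]

theorem wt_single_mem_block (i : Fin 4) : wt m (Pi.single i 1) ∈ block m i i := by
  intro p q h
  rw [wt, diagonal_apply]
  split_ifs with hpq
  · subst hpq
    rw [Pi.single_apply, if_neg fun h' => h ⟨h', h'⟩]
  · rfl

theorem IsRigidOfType.wt_mul_map_one {σ : Equiv.Perm (Fin 4)} {f : Mat m →⋆ₙₐ[ℂ] Mat n}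
    (hf : IsRigidOfType σ f) (w : Fin 4 → ℂ) : wt n w * f 1 = f (wt m (w ∘ σ)) := by
  rw [← wt_one, wt_eq_sum 1, wt_eq_sum (w ∘ σ)]
  simp only [map_sum, map_smul, Finset.mul_sum, mul_smul_comm]
  refine Finset.sum_congr rfl fun i _ => ?_
  rw [wt_mul_of_mem_block (hf.2.2 i i (Or.inl rfl) _ (wt_single_mem_block i)) w]
  simp

/-- On each summand the sign is the scalar by which its type acts on `g`; orthogonality of the
ranges removes the cross terms. -/
theorem isSignOf_of_isDirectSum {g : Fin 4 → ℂ} {s : ℕ} {φ : Mat m →⋆ₙₐ[ℂ] Mat n}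
    {f : Fin s → (Mat m →⋆ₙₐ[ℂ] Mat n)} (hf : IsDirectSum φ f) {σ : Fin s → Equiv.Perm (Fin 4)}
    (hσ : ∀ t, IsRigidOfType (σ t) (f t)) {ε : Fin s → ℂ} (hε : ∀ t, star (ε t) = ε t)
    (hε' : ∀ t, ε t * ε t = 1) (hg : ∀ t, g ∘ σ t = ε t • g) :
    IsSignOf g φ (∑ t, ε t • f t 1) := by
  have hl : ∀ x, φ x * ∑ t, ε t • f t 1 = ∑ t, ε t • f t x := by
    intro x
    rw [hf.2, Finset.sum_mul_sum]
    refine Finset.sum_congr rfl fun t _ => ?_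
    rw [Finset.sum_eq_single t, mul_smul_comm, map_mul_map_one]
    · intro t' _ h
      rw [mul_smul_comm, hf.1 t t' h.symm, smul_zero]
    · simp
  have hr : ∀ x, (∑ t, ε t • f t 1) * φ x = ∑ t, ε t • f t x := by
    intro x
    rw [hf.2, Finset.sum_mul_sum]
    refine Finset.sum_congr rfl fun t _ => ?_
    rw [Finset.sum_eq_single t, smul_mul_assoc, map_one_mul_map]
    · intro t' _ h
      rw [smul_mul_assoc, hf.1 t t' h.symm, smul_zero]
    · simp
  refine ⟨?_, fun x => ?_, ?_, ?_, ?_⟩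
  · rw [conjTranspose_sum]
    refine Finset.sum_congr rfl fun t _ => ?_
    rw [conjTranspose_smul, hε, ← map_conjTranspose', conjTranspose_one]
  · rw [Commute, SemiconjBy, hl, hr]
  · rw [hl]
  · rw [hf.2, Finset.sum_mul_sum]
    refine Finset.sum_congr rfl fun t _ => ?_
    rw [Finset.sum_eq_single t, smul_mul_assoc, mul_smul_comm, smul_smul, hε', one_smul,
      map_mul_map_one]
    · intro t' _ h
      rw [smul_mul_assoc, mul_smul_comm, hf.1 t t' h.symm, smul_zero, smul_zero]
    · simp
  · rw [hr, hf.2, Finset.mul_sum]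
    refine Finset.sum_congr rfl fun t _ => ?_
    rw [(hσ t).wt_mul_map_one, hg, wt_smul, map_smul]

/-- The pair `(u, v)` records how `φ` acts on the signs of the vertices of `D_4`. -/
structure IsAligned (φ : Mat m →⋆ₙₐ[ℂ] Mat n) (u v : Mat n) : Prop where
  left : IsSignOf gL φ u
  right : IsSignOf gR φ v

theorem IsRigid.exists_isAligned {φ : Mat m →⋆ₙₐ[ℂ] Mat n} (h : IsRigid φ) :
    ∃ u v, IsAligned φ u v ∧ Commute u v := by
  obtain ⟨-, s, f, hf, hσ⟩ := h
  choose σ hσ using hσ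
  choose ε h1 h2 h3 using fun t => (hσ t).1.exists_sign_left
  choose δ k1 k2 k3 using fun t => (hσ t).1.exists_sign_right
  refine ⟨_, _, ⟨isSignOf_of_isDirectSum hf hσ h1 h2 h3, isSignOf_of_isDirectSum hf hσ k1 k2 k3⟩,
    ?_⟩
  refine Commute.sum_left _ _ _ fun t _ => Commute.sum_right _ _ _ fun t' _ => ?_
  refine (Commute.smul_left ?_ _).smul_right _
  by_cases htt : t = t'
  · rw [htt]
    exact Commute.refl _
  · rw [Commute, SemiconjBy, hf.1 t t' htt, hf.1 t' t (Ne.symm htt)]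

theorem IsAligned.comp {k : Fin 4 → ℕ} {φ : Mat m →⋆ₙₐ[ℂ] Mat n} {ψ : Mat n →⋆ₙₐ[ℂ] Mat k}
    {u v : Mat n} {x y : Mat k} (h : IsAligned φ u v) (h' : IsAligned ψ x y) :
    IsAligned (ψ.comp φ) (ψ u * x) (ψ v * y) :=
  ⟨h.left.comp h'.left, h.right.comp h'.right⟩

theorem IsAligned.commute_comp {k : Fin 4 → ℕ} {ψ : Mat n →⋆ₙₐ[ℂ] Mat k}
    {u v : Mat n} {x y : Mat k} (h' : IsAligned ψ x y) (huv : Commute u v) (hxy : Commute x y) :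
    Commute (ψ u * x) (ψ v * y) :=
  ((huv.map ψ).mul_right (h'.right.comm u)).mul_left ((h'.left.comm v).symm.mul_right hxy)

theorem DirectSys.exists_isAligned_trans {S : DirectSys} (hS : ∀ k, IsRigid (S.map k)) {i j : ℕ}
    (h : i ≤ j) : ∃ u v, IsAligned (S.trans i j h) u v ∧ Commute u v := by
  induction j, h using Nat.le_induction with
  | base =>
    rw [S.trans_self]
    exact ⟨1, 1, ⟨.id, .id⟩, Commute.one_left 1⟩
  | succ j h ih =>
    obtain ⟨u, v, h1, h2⟩ := ih
    obtain ⟨x, y, h3, h4⟩ := (hS j).exists_isAligned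
    rw [S.trans_succ _ _ h]
    exact ⟨_, _, h1.comp h3, h3.commute_comp h2 h4⟩

/-- The sign attached to a boolean. -/
def sgn (b : Bool) : ℂ := if b then 1 else -1

/-- The symmetry of `D_4` with prescribed signs. -/
def signPerm (b : Bool × Bool) : Equiv.Perm (Fin 4) :=
  (if b.1 then 1 else Equiv.swap 0 1) * (if b.2 then 1 else Equiv.swap 2 3)

theorem isSymmetry_signPerm (b : Bool × Bool) : IsSymmetry (signPerm b) := by
  revert b
  unfold IsSymmetry Edge signPerm
  decide

/-- The values `(1,0)`, `(-1,0)`, `(0,1)`, `(0,-1)` of `(gL, gR)` separate the vertices. -/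
theorem eq_signPerm {b : Bool × Bool} {i j : Fin 4} (hL : gL j = sgn b.1 * gL i)
    (hR : gR j = sgn b.2 * gR i) : j = signPerm b i := by
  obtain ⟨b, c⟩ := b
  cases b <;> cases c <;> fin_cases i <;> fin_cases j <;>
    first
    | rfl
    | (exfalso; norm_num [gL, gR, sgn] at hL; done)
    | (exfalso; norm_num [gL, gR, sgn] at hR)

theorem isRigidOfType_isometryHom {σ : Equiv.Perm (Fin 4)} (hσ : IsSymmetry σ)
    {V : Matrix (Idx n) (Idx m) ℂ} (hV : Vᴴ * V = 1) (hs : ∀ r p, V r p ≠ 0 → r.1 = σ p.1) :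
    IsRigidOfType σ (isometryHom V hV) := by
  have key : ∀ (a : Mat m) (r s : Idx n), isometryHom V hV a r s ≠ 0 →
      ∃ p q, r.1 = σ p.1 ∧ s.1 = σ q.1 ∧ a p q ≠ 0 := by
    intro a r s h
    rw [isometryHom_apply, Matrix.mul_assoc, mul_apply] at h
    obtain ⟨p, -, hp⟩ := Finset.exists_ne_zero_of_sum_ne_zero h
    have hp2 := right_ne_zero_of_mul hp
    rw [mul_apply] at hp2
    obtain ⟨q, -, hq⟩ := Finset.exists_ne_zero_of_sum_ne_zero hp2
    refine ⟨p, q, hs _ _ (left_ne_zero_of_mul hp), hs _ _ ?_, left_ne_zero_of_mul hq⟩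
    have := right_ne_zero_of_mul hq
    rwa [conjTranspose_apply, star_ne_zero] at this
  refine ⟨hσ, ⟨⟨isometryHom_injective V hV, fun a ha r s hrs => ?_⟩, fun x hx => ?_⟩,
    fun i j _ a ha r s hrs => ?_⟩
  · by_contra h
    obtain ⟨p, q, h1, h2, h3⟩ := key a r s h
    refine h3 (ha p q fun he => hrs ?_)
    rw [h1, h2]
    exact (hσ _ _).1 he
  · rw [rank_isometryHom, hx]
  · by_contra h
    obtain ⟨p, q, h1, h2, h3⟩ := key a r s h
    refine h3 (ha p q fun he => hrs ?_)
    rw [h1, h2, he.1, he.2]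
    exact ⟨rfl, rfl⟩

end Rigid

theorem star_sgn (b : Bool) : star (sgn b) = sgn b := by cases b <;> simp [sgn]

theorem sgn_mul_sgn (b : Bool) : sgn b * sgn b = 1 := by cases b <;> simp [sgn]

/-! ### Rigid decompositions from commuting signs -/

section Spectral

variable {g : Fin 4 → ℂ} {m n : Fin 4 → ℕ} {φ : Mat m →⋆ₙₐ[ℂ] Mat n} {u v : Mat n}

/-- The spectral projections of a sign symmetry. -/
noncomputable def signProj (φ : Mat m →⋆ₙₐ[ℂ] Mat n) (u : Mat n) (b : Bool) : Mat n :=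
  (2⁻¹ : ℂ) • (φ 1 + sgn b • u)

namespace IsSignOf

theorem mul_map_one (h : IsSignOf g φ u) : u * φ 1 = u := by
  rw [← (h.comm 1).eq, h.one_mul]

theorem commute_signProj (h : IsSignOf g φ u) (b : Bool) (x : Mat m) :
    Commute (φ x) (signProj φ u b) := by
  refine Commute.smul_right (Commute.add_right ?_ ((h.comm x).smul_right _)) _
  rw [Commute, SemiconjBy, map_mul_map_one, map_one_mul_map]

theorem map_one_mul_signProj (h : IsSignOf g φ u) (b : Bool) :
    φ 1 * signProj φ u b = signProj φ u b := by
  rw [signProj, mul_smul_comm, mul_add, map_mul_map_one, mul_smul_comm, h.one_mul]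

theorem mul_signProj (h : IsSignOf g φ u) (b : Bool) :
    u * signProj φ u b = sgn b • signProj φ u b := by
  rw [signProj, mul_smul_comm, mul_add, mul_smul_comm, h.mul_map_one, h.sq, smul_comm (sgn b), smul_add (sgn b),
    smul_smul (sgn b), sgn_mul_sgn, one_smul, add_comm]

theorem isStarProjection_signProj (h : IsSignOf g φ u) (b : Bool) :
    IsStarProjection (signProj φ u b) where
  isIdempotentElem := by
    have h1 : signProj φ u b * signProj φ u b =
        (2⁻¹ : ℂ) • (φ 1 * signProj φ u b + sgn b • (u * signProj φ u b)) := by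
      conv_lhs => enter [1]; rw [signProj]
      rw [smul_mul_assoc, add_mul, smul_mul_assoc]
    rw [IsIdempotentElem, h1, h.map_one_mul_signProj, h.mul_signProj, smul_smul, sgn_mul_sgn,
      one_smul, ← two_smul ℂ, smul_smul, inv_mul_cancel₀ two_ne_zero, one_smul]
  isSelfAdjoint := by
    rw [IsSelfAdjoint, signProj, star_smul, star_add, star_smul, star_sgn, ← map_star, star_one,
      star_eq_conjTranspose u, h.star_eq]
    simp

theorem sum_signProj (φ : Mat m →⋆ₙₐ[ℂ] Mat n) (u : Mat n) : ∑ b, signProj φ u b = φ 1 := by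
  simp only [signProj, Fintype.sum_bool, sgn, if_true, Bool.false_eq_true, if_false]
  module

end IsSignOf

theorem commute_signProj_signProj (hu : IsSignOf g φ u) (hv : Commute v u)
    (hv' : ∀ x, Commute (φ x) v) (b c : Bool) :
    Commute (signProj φ u b) (signProj φ v c) := by
  refine Commute.smul_right (Commute.add_right ?_ (Commute.smul_right ?_ _)) _
  · exact (hu.commute_signProj b 1).symm
  · refine Commute.smul_left (Commute.add_left (hv' 1) (Commute.smul_left hv.symm _)) _

/-- The joint spectral projections of the signs of `φ`, below a projection in the range of `φ`. -/
noncomputable def jointProj (φ : Mat m →⋆ₙₐ[ℂ] Mat n) (u v : Mat n) (e : Mat m)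
    (b : Bool × Bool) : Mat n := signProj φ u b.1 * signProj φ v b.2 * φ e

namespace IsAligned

variable {e : Mat m}

theorem isStarProjection_jointProj (h : IsAligned φ u v) (huv : Commute u v)
    (he : IsStarProjection e) (b : Bool × Bool) : IsStarProjection (jointProj φ u v e b) := by
  refine IsStarProjection.mul (IsStarProjection.mul (h.left.isStarProjection_signProj _)
    (h.right.isStarProjection_signProj _)
    (commute_signProj_signProj h.left huv.symm h.right.comm _ _)) ?_ ?_
  · refine ⟨?_, ?_⟩
    · rw [IsIdempotentElem, ← map_mul, he.isIdempotentElem.eq]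
    · rw [IsSelfAdjoint, ← map_star, he.isSelfAdjoint.star_eq]
  · exact ((h.left.commute_signProj _ e).mul_right (h.right.commute_signProj _ e)).symm

theorem mul_jointProj_left (h : IsAligned φ u v) (b : Bool × Bool) :
    u * jointProj φ u v e b = sgn b.1 • jointProj φ u v e b := by
  rw [jointProj, ← mul_assoc, ← mul_assoc, h.left.mul_signProj, smul_mul_assoc, smul_mul_assoc]

theorem mul_jointProj_right (h : IsAligned φ u v) (huv : Commute u v) (b : Bool × Bool) :
    v * jointProj φ u v e b = sgn b.2 • jointProj φ u v e b := by
  rw [jointProj, (commute_signProj_signProj h.left huv.symm h.right.comm _ _).eq, ← mul_assoc,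
    ← mul_assoc, h.right.mul_signProj, smul_mul_assoc, smul_mul_assoc]

theorem jointProj_mul_left (h : IsAligned φ u v) (huv : Commute u v) (he : IsStarProjection e)
    (b : Bool × Bool) : jointProj φ u v e b * u = sgn b.1 • jointProj φ u v e b := by
  have hp : (jointProj φ u v e b)ᴴ = _ :=
    (h.isStarProjection_jointProj huv he b).isSelfAdjoint.star_eq
  have := congrArg conjTranspose (h.mul_jointProj_left (e := e) b)
  rwa [conjTranspose_mul, conjTranspose_smul, hp, h.left.star_eq, star_sgn] at this

theorem jointProj_mul_right (h : IsAligned φ u v) (huv : Commute u v) (he : IsStarProjection e)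
    (b : Bool × Bool) : jointProj φ u v e b * v = sgn b.2 • jointProj φ u v e b := by
  have hp : (jointProj φ u v e b)ᴴ = _ :=
    (h.isStarProjection_jointProj huv he b).isSelfAdjoint.star_eq
  have := congrArg conjTranspose (h.mul_jointProj_right huv (e := e) b)
  rwa [conjTranspose_mul, conjTranspose_smul, hp, h.right.star_eq, star_sgn] at this

theorem sum_jointProj (φ : Mat m →⋆ₙₐ[ℂ] Mat n) (u v : Mat n) (e : Mat m) :
    ∑ b, jointProj φ u v e b = φ e := by
  simp only [jointProj, ← Finset.sum_mul]
  rw [Fintype.sum_prod_type]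
  simp only [← Finset.mul_sum, IsSignOf.sum_signProj, ← Finset.sum_mul]
  rw [mul_assoc, map_one_mul_map, map_one_mul_map]

/-- Distinct labels are distinct eigenvalues of `u` or of `v`. -/
theorem jointProj_mul_jointProj (h : IsAligned φ u v) (huv : Commute u v)
    (he : IsStarProjection e) {b b' : Bool × Bool} (hb : b ≠ b') :
    jointProj φ u v e b * jointProj φ u v e b' = 0 := by
  have hs : ∀ {s t : ℂ}, s ≠ t → s • (jointProj φ u v e b * jointProj φ u v e b') =
      t • (jointProj φ u v e b * jointProj φ u v e b') →
      jointProj φ u v e b * jointProj φ u v e b' = 0 := by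
    intro s t hst heq
    rw [← sub_eq_zero, ← sub_smul] at heq
    exact (smul_eq_zero.1 heq).resolve_left (sub_ne_zero.2 hst)
  have hne : ∀ {c d : Bool}, c ≠ d → sgn c ≠ sgn d := by
    intro c d hcd
    cases c <;> cases d <;> norm_num [sgn] <;> simp_all
  by_cases h1 : b.1 = b'.1
  · have h2 : b.2 ≠ b'.2 := fun h2 => hb (Prod.ext h1 h2)
    refine hs (hne h2) ?_
    rw [← smul_mul_assoc, ← h.jointProj_mul_right huv he, mul_assoc, h.mul_jointProj_right huv,
      mul_smul_comm]
  · refine hs (hne h1) ?_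
    rw [← smul_mul_assoc, ← h.jointProj_mul_left huv he, mul_assoc, h.mul_jointProj_left,
      mul_smul_comm]

/-- The product of spectral projections is a combination of `φ 1`, `u`, `v`, `u * v`, so four traces
determine the multiplicities of all four types. -/
theorem trace_jointProj (h : IsAligned φ u v) (b : Bool × Bool) :
    (jointProj φ u v e b).trace = 4⁻¹ * ((φ e).trace + sgn b.1 * (u * φ e).trace +
      sgn b.2 * (v * φ e).trace + sgn b.1 * sgn b.2 * (u * v * φ e).trace) := by
  have h1 : jointProj φ u v e b = (4⁻¹ : ℂ) • (φ e + sgn b.1 • (u * φ e) +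
      sgn b.2 • (v * φ e) + (sgn b.1 * sgn b.2) • (u * v * φ e)) := by
    have h2 : signProj φ u b.1 * signProj φ v b.2 = (4⁻¹ : ℂ) • (φ 1 + sgn b.1 • u +
      sgn b.2 • v + (sgn b.1 * sgn b.2) • (u * v)) := by
      rw [signProj, signProj, smul_mul_assoc, mul_smul_comm, smul_smul, add_mul, mul_add, mul_add,
        map_mul_map_one, mul_smul_comm, h.right.one_mul, smul_mul_assoc, h.left.mul_map_one,
        smul_mul_assoc, mul_smul_comm, smul_smul]
      norm_num
      module
    rw [jointProj, h2, smul_mul_assoc, add_mul, add_mul, add_mul, smul_mul_assoc, smul_mul_assoc,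
      smul_mul_assoc, map_one_mul_map]
  rw [h1]
  simp only [trace_smul, trace_add, smul_eq_mul]

end IsAligned

theorem isStarProjection_single {ι : Type*} [Fintype ι] [DecidableEq ι] (o : ι) :
    IsStarProjection (single o o (1 : ℂ)) where
  isIdempotentElem := by rw [IsIdempotentElem, single_mul_single_same, one_mul]
  isSelfAdjoint := by
    rw [IsSelfAdjoint, star_eq_conjTranspose, conjTranspose_single, star_one]

/-- An embedding with commuting signs is a direct sum of multiplicity one rigid embeddings. -/
theorem IsAligned.exists_decomposition (h : IsAligned φ u v) (huv : Commute u v) (o : Idx m) :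
    ∃ (k : Bool × Bool → ℕ) (V : (Σ b, Fin (k b)) → Matrix (Idx n) (Idx m) ℂ),
      (∀ t, (V t)ᴴ * V t = 1) ∧ (∀ t t', t ≠ t' → (V t)ᴴ * V t' = 0) ∧
      (∀ x, φ x = ∑ t, V t * x * (V t)ᴴ) ∧ ∀ t r p, V t r p ≠ 0 → r.1 = signPerm t.1 p.1 := by
  have he := isStarProjection_single o
  choose k W hk hW hW' using fun b =>
    exists_isometry_of_isStarProjection (h.isStarProjection_jointProj huv he b)
  set P := jointProj φ u v (single o o 1) with hP
  have hPW : ∀ b, P b * W b = W b := by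
    intro b
    rw [← hW', Matrix.mul_assoc, hW, Matrix.mul_one]
  have heW : ∀ b, φ (single o o 1) * W b = W b := by
    intro b
    rw [← hPW, ← Matrix.mul_assoc, ← IsAligned.sum_jointProj φ u v, Finset.sum_mul,
      Finset.sum_eq_single b, (h.isStarProjection_jointProj huv he b).isIdempotentElem.eq]
    · intro b' _ hb
      exact h.jointProj_mul_jointProj huv he hb
    · simp
  have hWW : ∀ b b', b ≠ b' → (W b)ᴴ * W b' = 0 := by
    intro b b' hb
    have hPs : (P b)ᴴ = P b := (h.isStarProjection_jointProj huv he b).isSelfAdjoint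
    rw [← hPW b, ← hPW b', conjTranspose_mul, hPs, Matrix.mul_assoc, ← Matrix.mul_assoc (P b),
      h.jointProj_mul_jointProj huv he hb, Matrix.zero_mul, Matrix.mul_zero]
  -- Each column `ξ` of `W b` generates one multiplicity one summand: column `p` of its isometry is
  -- `φ (e_po) ξ`.
  let V : (Σ b, Fin (k b)) → Matrix (Idx n) (Idx m) ℂ := fun t =>
    of fun r p => (φ (single p o 1) * W t.1) r t.2
  have hVV : ∀ t t' p q, ((V t)ᴴ * V t') p q =
      if p = q then ((W t.1)ᴴ * W t'.1) t.2 t'.2 else 0 := by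
    intro t t' p q
    have h1 : ((V t)ᴴ * V t') p q =
      ((φ (single p o 1) * W t.1)ᴴ * (φ (single q o 1) * W t'.1)) t.2 t'.2 := rfl
    rw [h1, conjTranspose_mul, ← map_conjTranspose', conjTranspose_single, star_one,
      Matrix.mul_assoc, ← Matrix.mul_assoc (φ _) (φ _), ← map_mul]
    split_ifs with hpq
    · rw [hpq, single_mul_single_same, one_mul, heW]
    · rw [single_mul_single_of_ne _ _ _ _ hpq, map_zero, Matrix.zero_mul, Matrix.mul_zero,
        Matrix.zero_apply]
  refine ⟨k, V, fun t => ?_, fun t t' htt => ?_, fun x => ?_, fun t r p hrp => ?_⟩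
  · ext p q
    rw [hVV, hW, Matrix.one_apply_eq, Matrix.one_apply]
  · ext p q
    rw [hVV, Matrix.zero_apply]
    obtain ⟨b, t⟩ := t
    obtain ⟨b', t'⟩ := t'
    by_cases hb : b = b'
    · subst hb
      rw [hW, Matrix.one_apply_ne (fun h => htt (by simp only at h; rw [h])), ite_self]
    · rw [hWW b b' hb, Matrix.zero_apply, ite_self]
  · have h1 : ∀ p q c, φ (single p q c) = ∑ t, V t * single p q c * (V t)ᴴ := by
      intro p q c
      have h2 : single p q c = c • (single p o (1 : ℂ) * single o o 1 * single o q 1) := by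
        rw [single_mul_single_same, single_mul_single_same, smul_single]
        simp
      have h3 : φ (single p q c) = c • ∑ b, φ (single p o 1) * P b * φ (single o q 1) := by
        rw [h2, map_smul, map_mul, map_mul,
          ← IsAligned.sum_jointProj φ u v (single o o 1), Finset.mul_sum,
          Finset.sum_mul]
      have h4 : ∀ b, φ (single p o 1) * P b * φ (single o q 1) =
          (φ (single p o 1) * W b) * (φ (single q o 1) * W b)ᴴ := by
        intro b
        rw [conjTranspose_mul, ← map_conjTranspose', conjTranspose_single, star_one, ← hW']
        simp only [Matrix.mul_assoc]
      ext r s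
      rw [h3, Matrix.smul_apply, Matrix.sum_apply, Matrix.sum_apply, Fintype.sum_sigma,
        Finset.smul_sum]
      refine Finset.sum_congr rfl fun b _ => ?_
      rw [h4, Matrix.mul_apply (M := φ (single p o 1) * W b), Finset.smul_sum]
      refine Finset.sum_congr rfl fun t _ => ?_
      rw [Matrix.mul_apply (M := V _ * _), Finset.sum_eq_single q, mul_single_apply_same, conjTranspose_apply,
        conjTranspose_apply, smul_eq_mul]
      · simp only [V, of_apply]
        ring
      · intro q' _ hq
        rw [mul_single_apply_of_ne (hbj := hq), zero_mul]
      · simp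
    conv_lhs => rw [matrix_eq_sum_single x]
    conv_rhs => rw [matrix_eq_sum_single x]
    simp only [map_sum, h1, Matrix.mul_sum, Matrix.sum_mul]
    symm
    rw [Finset.sum_comm]
    exact Finset.sum_congr rfl fun p _ => Finset.sum_comm
  -- Column `p` is an eigenvector of `wt n g` with eigenvalue `s * g p.1`, so a nonzero entry in row
  -- `r` pins down the signs of the vertex `r.1`.
  · have key : ∀ (g : Fin 4 → ℂ) (u : Mat n) (s : ℂ), IsSignOf g φ u → u * P t.1 = s • P t.1 →
        g r.1 = s * g p.1 := by
      intro g u s hu hs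
      have h1 : wt n g * (φ (single p o 1) * W t.1) =
          (s * g p.1) • (φ (single p o 1) * W t.1) := by
        calc wt n g * (φ (single p o 1) * W t.1)
            = g p.1 • (φ (single p o 1) * (u * P t.1) * W t.1) := by
              rw [← Matrix.mul_assoc, hu.wt_mul_map, wt_mul_single, map_smul, mul_smul_comm,
                ← (hu.comm _).eq, Matrix.smul_mul, Matrix.mul_assoc, Matrix.mul_assoc,
                Matrix.mul_assoc, hPW]
          _ = (s * g p.1) • (φ (single p o 1) * W t.1) := by
              rw [hs, mul_smul_comm, Matrix.smul_mul, smul_smul, Matrix.mul_assoc, hPW, mul_comm s]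
      have h2 := congrFun (congrFun h1 r) t.2
      rw [wt, diagonal_mul, Matrix.smul_apply, smul_eq_mul] at h2
      exact mul_right_cancel₀ hrp h2
    exact eq_signPerm (key _ _ _ h.left (h.mul_jointProj_left _))
      (key _ _ _ h.right (h.mul_jointProj_right huv _))

end Spectral

/-! ### Unitary equivalence from equality of traces -/

section Equivalence

variable {m n : Fin 4 → ℕ} {φ : Mat m →⋆ₙₐ[ℂ] Mat n} {u v : Mat n}

/-- Embeddings with commuting signs are regular. -/
theorem IsAligned.isRegular (h : IsAligned φ u v) (huv : Commute u v)
    (hφ : Function.Injective φ) (o : Idx m) : IsRegular φ := by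
  obtain ⟨k, V, hV, hVV, hx, hs⟩ := h.exists_decomposition huv o
  let e := (Fintype.equivFin (Σ b, Fin (k b))).symm
  have hr : ∀ t, IsRigidOfType (signPerm (e t).1) (isometryHom (V (e t)) (hV _)) := fun t =>
    isRigidOfType_isometryHom (isSymmetry_signPerm _) (hV _) (hs _)
  have hsum : ∀ x, φ x = ∑ t, isometryHom (V (e t)) (hV _) x := by
    intro x
    rw [hx, ← e.sum_comp]
    rfl
  refine ⟨⟨hφ, fun a ha => ?_⟩, _, fun t => isometryHom (V (e t)) (hV _), ⟨?_, hsum⟩,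
    fun t => (hr t).2.1⟩
  · rw [hsum]
    exact sum_mem fun t _ => (hr t).2.1.1.2 a ha
  · intro t t' htt x y
    have h1 := hVV _ _ (e.injective.ne htt)
    rw [isometryHom_apply, isometryHom_apply]
    calc V (e t) * x * (V (e t))ᴴ * (V (e t') * y * (V (e t'))ᴴ)
        = V (e t) * x * ((V (e t))ᴴ * V (e t')) * y * (V (e t'))ᴴ := by
          simp only [Matrix.mul_assoc]
      _ = 0 := by rw [h1]; simp

theorem IsAligned.commute_wt_map_one (h : IsAligned φ u v) (w : Fin 4 → ℂ) :
    Commute (wt n w) (φ 1) := by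
  refine commute_wt_of_signs ?_ ?_ w
  · have h1 := h.left.map_mul_wt star_gL 1
    rw [one_mul, (h.left.comm _).eq, ← h.left.sign] at h1
    exact h1.symm
  · have h1 := h.right.map_mul_wt star_gR 1
    rw [one_mul, (h.right.comm _).eq, ← h.right.sign] at h1
    exact h1.symm

theorem isStarProjection_map (φ : Mat m →⋆ₙₐ[ℂ] Mat n) {e : Mat m} (he : IsStarProjection e) :
    IsStarProjection (φ e) where
  isIdempotentElem := by rw [IsIdempotentElem, ← map_mul, he.isIdempotentElem.eq]
  isSelfAdjoint := by rw [IsSelfAdjoint, ← map_star, he.isSelfAdjoint.star_eq]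

theorem isStarProjection_wt_single (i : Fin 4) : IsStarProjection (wt n (Pi.single i 1)) where
  isIdempotentElem := by
    rw [IsIdempotentElem, wt_mul_wt, ← Pi.single_mul, one_mul]
  isSelfAdjoint := by
    refine wt_conjTranspose ?_
    rw [Pi.star_single, star_one]

theorem sum_wt_single : ∑ i, wt n (Pi.single i 1) = 1 := by
  rw [← wt_one, wt_eq_sum 1]
  simp

theorem wt_single_mul_wt_single {i j : Fin 4} (h : i ≠ j) :
    wt n (Pi.single i 1) * wt n (Pi.single j 1) = 0 := by
  rw [wt_mul_wt, ← wt_zero]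
  congr 1
  ext l
  by_cases hl : l = i
  · subst hl; simp [h]
  · simp [hl]

theorem IsAligned.isStarProjection_compl (h : IsAligned φ u v) (i : Fin 4) :
    IsStarProjection (wt n (Pi.single i 1) * (1 - φ 1)) :=
  IsStarProjection.mul (isStarProjection_wt_single i)
    (isStarProjection_map φ (.one _)).one_sub
    ((Commute.one_right _).sub_right (h.commute_wt_map_one _))

theorem IsAligned.compl_mul_compl (h : IsAligned φ u v) {i j : Fin 4} (hij : i ≠ j) :
    wt n (Pi.single i 1) * (1 - φ 1) * (wt n (Pi.single j 1) * (1 - φ 1)) = 0 := by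
  have h1 : Commute (1 - φ 1) (wt n (Pi.single j 1)) :=
    ((Commute.one_right _).sub_right (h.commute_wt_map_one _)).symm
  rw [mul_assoc, ← mul_assoc (1 - φ 1), h1.eq, mul_assoc, ← mul_assoc,
    wt_single_mul_wt_single hij, zero_mul]

/-- Two embeddings with commuting signs are conjugate by a unitary of the range algebra if the
traces of their signs agree. -/
theorem exists_unitary_conj {α β : Mat m →⋆ₙₐ[ℂ] Mat n} {u v u' v' : Mat n}
    (hα : IsAligned α u v) (huv : Commute u v) (hβ : IsAligned β u' v') (huv' : Commute u' v')
    (o : Idx m) (htr : ∀ x, (α x).trace = (β x).trace)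
    (htru : ∀ x, (u * α x).trace = (u' * β x).trace)
    (htrv : ∀ x, (v * α x).trace = (v' * β x).trace)
    (htruv : ∀ x, (u * v * α x).trace = (u' * v' * β x).trace) :
    ∃ U : Mat n, Uᴴ * U = 1 ∧ U * Uᴴ = 1 ∧ (∀ w, Commute (wt n w) U) ∧
      ∀ x, U * α x * Uᴴ = β x := by
  have he := isStarProjection_single o
  set e : Mat m := single o o 1 with he'
  -- Equal traces match the four joint projections under the corner `e`, so `w` carries the signs of
  -- `α` to those of `β` there; the rest of the ranges follows by spreading `w` with matrix units.
  obtain ⟨w, hw1, hw2, hw3⟩ := exists_partialIsometry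
    (hα.isStarProjection_jointProj huv he) (hβ.isStarProjection_jointProj huv' he)
    (fun _ _ => hα.jointProj_mul_jointProj huv he)
    (fun _ _ => hβ.jointProj_mul_jointProj huv' he)
    (fun b => by rw [hα.trace_jointProj, hβ.trace_jointProj, htr, htru, htrv, htruv])
  have hw4 : w * α e = β e * w := by
    rw [← IsAligned.sum_jointProj α u v, ← IsAligned.sum_jointProj β u' v', Finset.mul_sum,
      Finset.sum_mul]
    exact Finset.sum_congr rfl fun b _ => hw3 b
  rw [IsAligned.sum_jointProj] at hw1 hw2
  have hw5 : w * α e = w :=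
    mul_eq_self_of_conjTranspose_mul (isStarProjection_map α he) hw1
  have hwu : w * u = u' * w := by
    have h1 : w * (∑ b, jointProj α u v e b * u) = (∑ b, u' * jointProj β u' v' e b) * w := by
      rw [Finset.mul_sum, Finset.sum_mul]
      refine Finset.sum_congr rfl fun b _ => ?_
      rw [hα.jointProj_mul_left huv he, hβ.mul_jointProj_left, mul_smul_comm, smul_mul_assoc, hw3]
    rwa [← Finset.sum_mul, ← Finset.mul_sum, IsAligned.sum_jointProj, IsAligned.sum_jointProj,
      ← mul_assoc, hw5, mul_assoc, ← hw4, hw5] at h1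
  have hwv : w * v = v' * w := by
    have h1 : w * (∑ b, jointProj α u v e b * v) = (∑ b, v' * jointProj β u' v' e b) * w := by
      rw [Finset.mul_sum, Finset.sum_mul]
      refine Finset.sum_congr rfl fun b _ => ?_
      rw [hα.jointProj_mul_right huv he, hβ.mul_jointProj_right huv', mul_smul_comm,
        smul_mul_assoc, hw3]
    rwa [← Finset.sum_mul, ← Finset.mul_sum, IsAligned.sum_jointProj, IsAligned.sum_jointProj,
      ← mul_assoc, hw5, mul_assoc, ← hw4, hw5] at h1
  set U₀ : Mat n := intertwiner α β o w with hU₀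
  have hU1 : U₀ᴴ * U₀ = α 1 := conjTranspose_intertwiner_mul hw1 (by rw [← hw4, hw5])
  have hU2 : U₀ * U₀ᴴ = β 1 := by
    have h1 : (intertwiner β α o wᴴ)ᴴ = U₀ := by
      rw [conjTranspose_intertwiner, conjTranspose_conjTranspose]
    have h2 : U₀ᴴ = intertwiner β α o wᴴ := conjTranspose_intertwiner
    have hs : (α e)ᴴ = α e := (isStarProjection_map α he).isSelfAdjoint
    rw [h2, ← h1]
    refine conjTranspose_intertwiner_mul (by rwa [conjTranspose_conjTranspose]) ?_
    have h3 := congrArg conjTranspose hw5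
    rwa [conjTranspose_mul, hs] at h3
  -- On the term for `p`, the weight acts from the left as `g p.1` times `s'` and from the right as
  -- `g p.1` times `s`; these agree since `w` intertwines `s` and `s'`.
  have hsign : ∀ {g : Fin 4 → ℂ} {s s' : Mat n}, star g = g → IsSignOf g α s →
      IsSignOf g β s' → w * s = s' * w → Commute (wt n g) U₀ := by
    intro g s s' hg hs hs' hws
    rw [Commute, SemiconjBy, hU₀, intertwiner, Finset.mul_sum, Finset.sum_mul]
    refine Finset.sum_congr rfl fun p _ => ?_
    rw [← mul_assoc, ← mul_assoc, hs'.wt_mul_map, wt_mul_single, map_smul, mul_assoc _ _ (wt n g),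
      hs.map_mul_wt hg, single_mul_wt, map_smul, (hs'.comm _).symm.smul_right _ |>.eq]
    simp only [smul_mul_assoc, mul_smul_comm]
    rw [mul_assoc (β _) s', ← hws, (hs.comm _).eq]
    simp only [mul_assoc]
  have hwt := commute_wt_of_signs (hsign star_gL hα.left hβ.left hwu)
    (hsign star_gR hα.right hβ.right hwv)
  -- It remains to match the complements of the ranges block by block. Their traces agree because
  -- `U₀` carries `α 1` to `β 1` and commutes with the block projections.
  obtain ⟨C, hC1, hC2, hC3⟩ := exists_partialIsometry
    hα.isStarProjection_compl hβ.isStarProjection_compl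
    (fun _ _ => hα.compl_mul_compl) (fun _ _ => hβ.compl_mul_compl) (fun i => by
      have h1 : (wt n (Pi.single i 1) * α 1).trace = (wt n (Pi.single i 1) * β 1).trace := by
        rw [← hU1, ← hU2, ← mul_assoc, trace_mul_comm, ← mul_assoc, ← mul_assoc, (hwt _).eq]
      rw [mul_sub, mul_sub, trace_sub, trace_sub, h1])
  have hC4 : Cᴴ * C = 1 - α 1 := by rw [hC1, ← Finset.sum_mul, sum_wt_single, one_mul]
  have hC5 : C * Cᴴ = 1 - β 1 := by rw [hC2, ← Finset.sum_mul, sum_wt_single, one_mul]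
  have pα : IsStarProjection (1 - α 1) := (isStarProjection_map α (.one _)).one_sub
  have pβ : IsStarProjection (1 - β 1) := (isStarProjection_map β (.one _)).one_sub
  have hC6 : C * (1 - α 1) = C := mul_eq_self_of_conjTranspose_mul pα hC4
  have hC7 : (1 - β 1) * C = C := by
    have h1 : Cᴴ * (1 - β 1) = Cᴴ :=
      mul_eq_self_of_conjTranspose_mul pβ (by rwa [conjTranspose_conjTranspose])
    have h2 := congrArg conjTranspose h1
    have hs : (1 - β 1)ᴴ = 1 - β 1 := pβ.isSelfAdjoint
    rwa [conjTranspose_mul, hs, conjTranspose_conjTranspose] at h2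
  have hU3 : U₀ * α 1 = U₀ := mul_eq_self_of_conjTranspose_mul (isStarProjection_map α (.one _)) hU1
  have hU4 : U₀ᴴ * β 1 = U₀ᴴ :=
    mul_eq_self_of_conjTranspose_mul (isStarProjection_map β (.one _))
      (by rwa [conjTranspose_conjTranspose])
  have hCα : ∀ x, C * α x = 0 := by
    intro x
    rw [← hC6, mul_assoc, sub_mul, map_one_mul_map, one_mul, sub_self, mul_zero]
  have hx1 : U₀ᴴ * C = 0 := by
    rw [← hU4, ← hC7, mul_assoc, ← mul_assoc (β 1), mul_sub, mul_one, map_mul_map_one, sub_self,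
      zero_mul, mul_zero]
  have hx2 : U₀ * Cᴴ = 0 := by
    have h1 := congrArg conjTranspose (hCα 1)
    rw [conjTranspose_mul, ← map_conjTranspose', conjTranspose_one, conjTranspose_zero] at h1
    rw [← hU3, mul_assoc, h1, mul_zero]
  have hx1' : Cᴴ * U₀ = 0 := by
    have h1 := congrArg conjTranspose hx1
    rwa [conjTranspose_mul, conjTranspose_conjTranspose, conjTranspose_zero] at h1
  have hx2' : C * U₀ᴴ = 0 := by
    have h1 := congrArg conjTranspose hx2
    rwa [conjTranspose_mul, conjTranspose_conjTranspose, conjTranspose_zero] at h1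
  have hCw : ∀ i, Commute (wt n (Pi.single i 1)) C := by
    intro i
    have h1 := hC3 i
    rw [((Commute.one_right _).sub_right (hα.commute_wt_map_one _)).eq, ← mul_assoc, hC6,
      mul_assoc, hC7] at h1
    exact h1.symm
  refine ⟨U₀ + C, ?_, ?_, fun w => ?_, fun x => ?_⟩
  · rw [conjTranspose_add, add_mul, mul_add, mul_add, hU1, hx1, hx1', hC4]
    abel
  · rw [conjTranspose_add, add_mul, mul_add, mul_add, hU2, hx2, hx2', hC5]
    abel
  · refine (hwt w).add_right ?_
    rw [wt_eq_sum]
    exact Commute.sum_left _ _ _ fun i _ => (hCw i).smul_left _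
  · rw [add_mul, hCα, add_zero, intertwiner_mul, conjTranspose_add, mul_add, mul_assoc, hU2,
      map_mul_map_one, mul_assoc, hx2, mul_zero, add_zero]

end Equivalence

/-! ### Block diagonal elements of a 4-cycle algebra -/

section Algebra

variable {n : Fin 4 → ℕ}

theorem gL_sq_apply (i : Fin 4) : (gL * gL) i = if i.val < 2 then 1 else 0 := by
  fin_cases i <;> simp [gL]

theorem gR_sq_apply (i : Fin 4) : (gR * gR) i = if i.val < 2 then 0 else 1 := by
  fin_cases i <;> simp [gR]

theorem wt_gL_sq_add_wt_gR_sq : wt n (gL * gL) + wt n (gR * gR) = 1 := by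
  rw [← wt_add, gL_sq_add_gR_sq, wt_one]

theorem single_mem_algebra {p q : Idx n} (h : Edge p.1 q.1) :
    single p q (1 : ℂ) ∈ algebra n := by
  intro r s hrs
  rw [single_apply, if_neg]
  rintro ⟨rfl, rfl⟩
  exact hrs h

/-- No edge other than a loop is reversible, so such an element is block diagonal. -/
theorem commute_wt_of_mem_algebra {a : Mat n} (ha : a ∈ algebra n) (ha' : aᴴ ∈ algebra n)
    (w : Fin 4 → ℂ) : Commute (wt n w) a := by
  ext p q
  rw [wt_mul_apply, mul_wt_apply]
  by_cases h : p.1 = q.1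
  · rw [h, mul_comm]
  · have h0 : a p q = 0 := by
      by_cases hpq : Edge p.1 q.1
      · have h1 : ¬ Edge q.1 p.1 := by
          unfold Edge at hpq ⊢
          grind
        have h2 := ha' q p h1
        rwa [conjTranspose_apply, star_eq_zero] at h2
      · exact ha p q hpq
    rw [h0, mul_zero, zero_mul]

theorem wt_gR_sq_mul_mul_wt_gL_sq {a : Mat n} (ha : a ∈ algebra n) :
    wt n (gR * gR) * a * wt n (gL * gL) = 0 := by
  ext p q
  rw [mul_wt_apply, wt_mul_apply, gL_sq_apply, gR_sq_apply, Matrix.zero_apply]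
  by_cases hp : p.1.val < 2
  · simp [hp]
  · by_cases hq : q.1.val < 2
    · rw [ha p q (by unfold Edge; grind)]
      simp
    · simp [hq]

/-- An edge ending in `{0, 1}` is a loop, so `a` is block diagonal. -/
theorem conjTranspose_mem_algebra_of_left {a : Mat n} (ha : a ∈ algebra n)
    (h : a * wt n (gL * gL) = a) : aᴴ ∈ algebra n := by
  intro p q hpq
  rw [conjTranspose_apply, star_eq_zero]
  by_cases hp : p.1.val < 2
  · refine ha q p fun he => hpq ?_
    unfold Edge at he ⊢
    grind
  · rw [← h, mul_wt_apply, gL_sq_apply, if_neg hp, mul_zero]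

/-- An edge starting in `{2, 3}` is a loop, so `a` is block diagonal. -/
theorem conjTranspose_mem_algebra_of_right {a : Mat n} (ha : a ∈ algebra n)
    (h : wt n (gR * gR) * a = a) : aᴴ ∈ algebra n := by
  intro p q hpq
  rw [conjTranspose_apply, star_eq_zero]
  by_cases hq : q.1.val < 2
  · rw [← h, wt_mul_apply, gR_sq_apply, if_pos hq, zero_mul]
  · refine ha q p fun he => hpq ?_
    unfold Edge at he ⊢
    grind

theorem IsStarExtEmbedding.commute_wt_map {m : Fin 4 → ℕ} {φ : Mat m →⋆ₙₐ[ℂ] Mat n}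
    (hφ : IsStarExtEmbedding φ) {a : Mat m} (ha : a ∈ algebra m) (ha' : aᴴ ∈ algebra m)
    (w : Fin 4 → ℂ) : Commute (wt n w) (φ a) :=
  commute_wt_of_mem_algebra (hφ.2 a ha) (by rw [← map_conjTranspose']; exact hφ.2 _ ha') w

theorem IsStarExtEmbedding.commute_wt_map_single {m : Fin 4 → ℕ} {φ : Mat m →⋆ₙₐ[ℂ] Mat n}
    (hφ : IsStarExtEmbedding φ) {p q : Idx m} (hpq : p.1 = q.1)
    (w : Fin 4 → ℂ) : Commute (wt n w) (φ (single p q 1)) :=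
  hφ.commute_wt_map (single_mem_algebra (Or.inl hpq)) (by
    rw [conjTranspose_single, star_one]; exact single_mem_algebra (Or.inl hpq.symm)) w

end Algebra

/-! ### Factors of aligned compositions preserve the vertex pairs -/

section Ranges

variable {m n k l : Fin 4 → ℕ}

theorem IsAligned.wt_gR_sq_mul {θ : Mat m →⋆ₙₐ[ℂ] Mat n} {u v : Mat n} (h : IsAligned θ u v)
    (x : Mat m) : wt n (gR * gR) * θ (wt m (gL * gL) * x) = 0 := by
  rw [← wt_mul_wt, mul_assoc, h.right.wt_mul_map, ← mul_assoc (wt m _), wt_mul_wt]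
  have : gR * (gL * gL) = 0 := by rw [← mul_assoc, mul_comm gR, gL_mul_gR, zero_mul]
  rw [this, wt_zero, zero_mul, map_zero, mul_zero, mul_zero]

theorem IsAligned.wt_gL_sq_mul {θ : Mat m →⋆ₙₐ[ℂ] Mat n} {u v : Mat n} (h : IsAligned θ u v)
    (x : Mat m) : wt n (gL * gL) * θ (wt m (gR * gR) * x) = 0 := by
  rw [← wt_mul_wt, mul_assoc, h.left.wt_mul_map, ← mul_assoc (wt m _), wt_mul_wt]
  have : gL * (gR * gR) = 0 := by rw [← mul_assoc, gL_mul_gR, zero_mul]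
  rw [this, wt_zero, zero_mul, map_zero, mul_zero, mul_zero]

/-- Otherwise `χ (ψ (e_qp))` would lie in the 4-cycle algebra, while alignment of the composition
gives it rows in `{2, 3}` and columns in `{0, 1}`. Only zero satisfies both, against injectivity. -/
theorem conjTranspose_map_single_notMem {ψ : Mat n →⋆ₙₐ[ℂ] Mat k} {χ : Mat k →⋆ₙₐ[ℂ] Mat l}
    (hψ : IsStarExtEmbedding ψ) (hχ : IsStarExtEmbedding χ) {u v : Mat l}
    (h : IsAligned (χ.comp ψ) u v) {p q : Idx n} (hp : p.1.val < 2) (hq : ¬ q.1.val < 2) :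
    (ψ (single p q 1))ᴴ ∉ algebra k := by
  intro hmem
  have h1 := hχ.2 _ hmem
  rw [← map_conjTranspose', conjTranspose_single, star_one] at h1
  have hq' : wt n (gR * gR) * single q p (1 : ℂ) = single q p 1 := by
    rw [wt_mul_single, gR_sq_apply, if_neg hq, one_smul]
  have hp' : wt n (gL * gL) * single p q (1 : ℂ) = single p q 1 := by
    rw [wt_mul_single, gL_sq_apply, if_pos hp, one_smul]
  have h2 : wt l (gL * gL) * χ (ψ (single q p 1)) = 0 := by
    rw [← hq']; exact h.wt_gL_sq_mul _
  have h3 : χ (ψ (single q p 1)) * wt l (gR * gR) = 0 := by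
    have h4 : wt l (gR * gR) * χ (ψ (single p q 1)) = 0 := by
      rw [← hp']; exact h.wt_gR_sq_mul _
    have h5 := congrArg conjTranspose h4
    rwa [conjTranspose_mul, ← map_conjTranspose', ← map_conjTranspose', conjTranspose_single,
      star_one, wt_conjTranspose (by rw [star_mul, star_gR]), conjTranspose_zero] at h5
  have h6 : χ (ψ (single q p 1)) = 0 := by
    calc χ (ψ (single q p 1)) = (wt l (gL * gL) + wt l (gR * gR)) * χ (ψ (single q p 1)) *
        (wt l (gL * gL) + wt l (gR * gR)) := by rw [wt_gL_sq_add_wt_gR_sq, one_mul, mul_one]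
      _ = 0 := by
        rw [add_mul, h2, zero_add, mul_add, wt_gR_sq_mul_mul_wt_gL_sq h1, mul_assoc, h3, mul_zero,
          zero_add]
  have h7 : single q p (1 : ℂ) = 0 := hψ.1 (hχ.1 (by rw [h6, map_zero, map_zero]))
  have h8 := congrFun (congrFun h7 q) p
  rw [single_apply_same] at h8
  exact one_ne_zero h8

/-- If the product of `φ (wt m w)` and `wt n w'` is nonzero and `wt k w'` annihilates the range of
`ψ ∘ φ` on `wt m w`, then it annihilates the image of a diagonal matrix unit. -/
theorem exists_wt_mul_map_single_eq_zero {φ : Mat m →⋆ₙₐ[ℂ] Mat n} {ψ : Mat n →⋆ₙₐ[ℂ] Mat k}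
    (hψ : IsStarExtEmbedding ψ) {w w' : Fin 4 → ℂ} (hne : wt n w' * φ (wt m w) ≠ 0)
    (h0 : wt k w' * ψ (φ (wt m w)) = 0) :
    ∃ p : Idx n, w' p.1 ≠ 0 ∧ wt k w' * ψ (single p p 1) = 0 := by
  obtain ⟨p, s, hps⟩ : ∃ p s, (wt n w' * φ (wt m w)) p s ≠ 0 := by
    by_contra! h'
    exact hne (Matrix.ext h')
  rw [wt_mul_apply] at hps
  refine ⟨p, left_ne_zero_of_mul hps, ?_⟩
  have h1 : single p p (1 : ℂ) =
      ((φ (wt m w)) p s)⁻¹ • (single p p 1 * φ (wt m w) * single s p 1) := by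
    rw [single_mul_mul_single, smul_single, one_mul, mul_one, smul_eq_mul,
      inv_mul_cancel₀ (right_ne_zero_of_mul hps)]
  rw [h1, map_smul, map_mul, map_mul, mul_smul_comm, ← mul_assoc, ← mul_assoc,
    (hψ.commute_wt_map_single rfl w').eq, mul_assoc (ψ _) (wt k w'), h0, mul_zero, zero_mul,
    smul_zero]

/-- If `φ` moved part of the pair `{0, 1}` to an index `p` over `{2, 3}`, alignment of `ψ ∘ φ` would
put `ψ (e_pp)` back over `{0, 1}`. For `q` over `{0, 1}` the edge element `ψ (e_qp)` would then be
block diagonal, which `conjTranspose_map_single_notMem` excludes. -/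
theorem wt_gR_sq_mul_map_eq_zero {φ : Mat m →⋆ₙₐ[ℂ] Mat n} {ψ : Mat n →⋆ₙₐ[ℂ] Mat k}
    {χ : Mat k →⋆ₙₐ[ℂ] Mat l} (hn : ∀ i, 0 < n i)
    (hψ : IsStarExtEmbedding ψ) (hχ : IsStarExtEmbedding χ) {u v : Mat k} {u' v' : Mat l}
    (h : IsAligned (ψ.comp φ) u v) (h' : IsAligned (χ.comp ψ) u' v') :
    wt n (gR * gR) * φ (wt m (gL * gL)) = 0 := by
  by_contra hne
  have h0 := h.wt_gR_sq_mul 1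
  rw [mul_one] at h0
  obtain ⟨p, hp, hp0⟩ := exists_wt_mul_map_single_eq_zero hψ hne h0
  have hp' : ¬ p.1.val < 2 := fun hlt => hp (by rw [gR_sq_apply, if_pos hlt])
  let q : Idx n := ⟨0, ⟨0, hn 0⟩⟩
  have hq : q.1.val < 2 := by simp [q]
  have hmem := hψ.2 _ (single_mem_algebra (p := q) (q := p) (Or.inr ⟨hq, not_lt.1 hp'⟩))
  refine conjTranspose_map_single_notMem hψ hχ h' hq hp'
    (conjTranspose_mem_algebra_of_left hmem ?_)
  have h1 : ψ (single q p 1) * wt k (gR * gR) = 0 := by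
    have h2 : single q p (1 : ℂ) = single q p 1 * single p p 1 := by
      rw [single_mul_single_same, one_mul]
    rw [h2, map_mul, mul_assoc, ← (hψ.commute_wt_map_single rfl _).eq, hp0, mul_zero]
  conv_rhs => rw [← mul_one (ψ (single q p 1)), ← wt_gL_sq_add_wt_gR_sq, mul_add, h1, add_zero]

theorem wt_gL_sq_mul_map_eq_zero {φ : Mat m →⋆ₙₐ[ℂ] Mat n} {ψ : Mat n →⋆ₙₐ[ℂ] Mat k}
    {χ : Mat k →⋆ₙₐ[ℂ] Mat l} (hn : ∀ i, 0 < n i)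
    (hψ : IsStarExtEmbedding ψ) (hχ : IsStarExtEmbedding χ) {u v : Mat k} {u' v' : Mat l}
    (h : IsAligned (ψ.comp φ) u v) (h' : IsAligned (χ.comp ψ) u' v') :
    wt n (gL * gL) * φ (wt m (gR * gR)) = 0 := by
  by_contra hne
  have h0 := h.wt_gL_sq_mul 1
  rw [mul_one] at h0
  obtain ⟨p, hp, hp0⟩ := exists_wt_mul_map_single_eq_zero hψ hne h0
  have hp' : p.1.val < 2 := by
    by_contra hlt
    exact hp (by rw [gL_sq_apply, if_neg hlt])
  let q : Idx n := ⟨2, ⟨0, hn 2⟩⟩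
  have hq : ¬ q.1.val < 2 := by simp [q]
  have hmem := hψ.2 _ (single_mem_algebra (p := p) (q := q) (Or.inr ⟨hp', not_lt.1 hq⟩))
  refine conjTranspose_map_single_notMem hψ hχ h' hp' hq
    (conjTranspose_mem_algebra_of_right hmem ?_)
  have h1 : wt k (gL * gL) * ψ (single p q 1) = 0 := by
    have h2 : single p q (1 : ℂ) = single p p 1 * single p q 1 := by
      rw [single_mul_single_same, one_mul]
    rw [h2, map_mul, ← mul_assoc, hp0, zero_mul]
  conv_rhs => rw [← one_mul (ψ (single p q 1)), ← wt_gL_sq_add_wt_gR_sq, add_mul, h1, zero_add]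

end Ranges

/-! ### Signs of the factors of a composition -/

section Signs

variable {m n k : Fin 4 → ℕ}

theorem wt_eq_sum_single (w : Fin 4 → ℂ) : wt n w = ∑ p, w p.1 • single p p (1 : ℂ) := by
  rw [← mul_one (wt n w), ← sum_single_diag, Finset.mul_sum]
  exact Finset.sum_congr rfl fun p _ => wt_mul_single w p p

/-- On the corner of one matrix unit `e_oo` in block `i` the weight acts as a self-adjoint element
with square the identity of that corner; spreading it by matrix units gives an element of the
commutant. It represents `g` on block `i` only, and the signs of different blocks must still be
compared. -/
theorem exists_blockSign {g : Fin 4 → ℂ} (hg : star g = g) {φ : Mat m →⋆ₙₐ[ℂ] Mat n}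
    (hφ : IsStarExtEmbedding φ) {i : Fin 4} (hm : 0 < m i)
    (hr : wt n (g * g) * φ (wt m (Pi.single i 1)) = φ (wt m (Pi.single i 1))) :
    ∃ u : Mat n, uᴴ = u ∧ (∀ x, Commute (φ x) u) ∧ φ 1 * u = u ∧ u * u = φ 1 ∧
      wt n g * φ (wt m (Pi.single i 1)) = u * φ (wt m (Pi.single i 1)) := by
  let o : Idx m := ⟨i, ⟨0, hm⟩⟩
  have hro : wt n (g * g) * φ (single o o 1) = φ (single o o 1) := by
    have h : single o o (1 : ℂ) = wt m (Pi.single i 1) * single o o 1 := by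
      rw [wt_mul_single]
      simp [o]
    rw [h, map_mul, ← mul_assoc, hr]
  have hone : φ 1 * intertwiner φ φ o (wt n g) = intertwiner φ φ o (wt n g) := by
    rw [intertwiner, Finset.mul_sum]
    refine Finset.sum_congr rfl fun p _ => ?_
    rw [← mul_assoc, ← mul_assoc, map_one_mul_map]
  refine ⟨intertwiner φ φ o (wt n g), ?_, fun x => (intertwiner_mul x).symm, hone, ?_, ?_⟩
  · rw [conjTranspose_intertwiner, wt_conjTranspose hg]
  · conv_lhs => enter [1]; rw [intertwiner]
    rw [Finset.sum_mul, ← sum_single_diag, map_sum]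
    refine Finset.sum_congr rfl fun p _ => ?_
    rw [mul_assoc, map_single_mul_intertwiner, ← (hφ.commute_wt_map_single rfl g).eq, mul_assoc,
      ← mul_assoc (wt n g), ← mul_assoc (wt n g), wt_mul_wt, hro, ← map_mul, ← map_mul,
      single_mul_single_same, single_mul_single_same]
    simp
  · have key : ∀ p : Idx m, p.1 = i → wt n g * φ (single p p 1) =
        intertwiner φ φ o (wt n g) * φ (single p p 1) := by
      intro p hp
      have h1 : single p p (1 : ℂ) = single p o 1 * single o p 1 := by
        rw [single_mul_single_same, one_mul]
      have h2 : single p o (1 : ℂ) * single o o 1 = single p o 1 := by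
        rw [single_mul_single_same, one_mul]
      rw [intertwiner_mul, h1, map_mul, mul_assoc (φ (single p o 1)) (φ (single o p 1)),
        map_single_mul_intertwiner, ← mul_assoc (φ (single p o 1)), ← mul_assoc (φ (single p o 1)),
        ← map_mul φ (single p o 1) (single o o 1), h2, ← mul_assoc, (hφ.commute_wt_map_single hp g).eq]
    rw [wt_eq_sum_single (Pi.single i 1), map_sum, Finset.mul_sum, Finset.mul_sum]
    refine Finset.sum_congr rfl fun p _ => ?_
    rw [map_smul, mul_smul_comm, mul_smul_comm]
    by_cases hp : p.1 = i
    · rw [key p hp]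
    · simp [hp]

/-- The signs of a vertex pair `i, j` are carried to signs by both factors of a composition if
they are by the composition itself. -/
theorem eq_neg_of_comp {g : Fin 4 → ℂ} {i j : Fin 4} (hij : i ≠ j)
    (hg : g = Pi.single i 1 - Pi.single j 1)
    {φ : Mat m →⋆ₙₐ[ℂ] Mat n} {ψ : Mat n →⋆ₙₐ[ℂ] Mat k} (hm : ∀ i, 0 < m i)
    (hφ0 : φ 1 ≠ 0) (hψ0 : ψ 1 ≠ 0)
    (hr : wt n (g * g) * φ (wt m (g * g)) = φ (wt m (g * g)))
    {u₀ u₁ : Mat n} {x₀ x₁ c : Mat k}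
    (hu₀ : ∀ x, Commute (φ x) u₀) (hu₁ : ∀ x, Commute (φ x) u₁)
    (hu₀' : φ 1 * u₀ = u₀) (hu₁' : φ 1 * u₁ = u₁)
    (hs₀ : wt n g * φ (wt m (Pi.single i 1)) = u₀ * φ (wt m (Pi.single i 1)))
    (hs₁ : wt n g * φ (wt m (Pi.single j 1)) = u₁ * φ (wt m (Pi.single j 1)))
    (hx₀ : ∀ x, Commute (ψ x) x₀) (hx₁ : ∀ x, Commute (ψ x) x₁)
    (hx₀' : ψ 1 * x₀ = x₀) (hx₁' : ψ 1 * x₁ = x₁) (hx₀2 : x₀ * x₀ = ψ 1) (hx₁2 : x₁ * x₁ = ψ 1)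
    (ht₀ : wt k g * ψ (wt n (Pi.single i 1)) = x₀ * ψ (wt n (Pi.single i 1)))
    (ht₁ : wt k g * ψ (wt n (Pi.single j 1)) = x₁ * ψ (wt n (Pi.single j 1)))
    (hc : IsSignOf g (ψ.comp φ) c) : u₁ = -u₀ ∧ x₁ = -x₀ := by
  have hgg : g * g = Pi.single i 1 + Pi.single j 1 := by
    rw [hg]
    ext a
    by_cases h1 : a = i
    · subst h1; simp [hij]
    · by_cases h2 : a = j
      · subst h2; simp [h1]
      · simp [h1, h2]
  have hfi : (Pi.single i 1 : Fin 4 → ℂ) = (2⁻¹ : ℂ) • (g * g + g) := by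
    rw [hgg, hg]; module
  have hfj : (Pi.single j 1 : Fin 4 → ℂ) = (2⁻¹ : ℂ) • (g * g - g) := by
    rw [hgg, hg]; module
  -- The parts of `φ f` in the middle blocks `i` and `j` are cut out by `(φ 1 ± u) / 2`, and `ψ`
  -- applies `x₀` to the one and `x₁` to the other. The total must be `ε • c`, with `ε` the value of
  -- `g` at `a`; the factor `f` then cancels.
  have step : ∀ (a : Fin 4) (u : Mat n) (ε : ℂ), (∀ x, Commute (φ x) u) → φ 1 * u = u →
      wt n g * φ (wt m (Pi.single a 1)) = u * φ (wt m (Pi.single a 1)) →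
      g * g * Pi.single a 1 = Pi.single a 1 → g * Pi.single a 1 = ε • Pi.single a 1 →
      ψ (φ 1 + u) * x₀ + ψ (φ 1 - u) * x₁ = (2 * ε) • c := by
    intro a u ε hu hu' hs hga hga'
    set f := wt m (Pi.single a 1) with hf
    have h1 : wt n (g * g) * φ f = φ f := by
      have h0 : wt m (g * g) * f = f := by rw [hf, wt_mul_wt, hga]
      rw [← h0, map_mul, ← mul_assoc, hr]
    have h2 : wt n (Pi.single i 1) * φ f = (2⁻¹ : ℂ) • ((φ 1 + u) * φ f) := by
      rw [hfi, wt_smul, wt_add, smul_mul_assoc, add_mul, h1, hs, add_mul, map_one_mul_map]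
    have h3 : wt n (Pi.single j 1) * φ f = (2⁻¹ : ℂ) • ((φ 1 - u) * φ f) := by
      rw [hfj, wt_smul, sub_eq_add_neg, wt_add, ← neg_one_smul ℂ g, wt_smul, smul_mul_assoc,
        add_mul, h1, smul_mul_assoc, hs, sub_mul, map_one_mul_map]
      module
    have h4 : wt k g * ψ (φ f) = x₀ * ψ (wt n (Pi.single i 1) * φ f) +
        x₁ * ψ (wt n (Pi.single j 1) * φ f) := by
      conv_lhs => rw [← h1, hgg, wt_add, add_mul, map_add, mul_add, map_mul, map_mul,
        ← mul_assoc, ht₀, ← mul_assoc, ht₁, mul_assoc, mul_assoc, ← map_mul, ← map_mul]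
    have h5 : wt k g * ψ (φ f) = ε • (c * ψ (φ f)) := by
      have := hc.wt_mul_map f
      rw [hf, wt_mul_wt, hga', wt_smul, map_smul, mul_smul_comm] at this
      exact this
    have h6 : (ψ.comp φ) 1 * (ψ (φ 1 + u) * x₀ + ψ (φ 1 - u) * x₁ - (2 * ε) • c) = 0 := by
      refine map_one_mul_eq_zero (x := f) (fun x => ?_) (wt_ne_zero hm (i := a) (by simp)) ?_
      · have e1 : Commute (ψ (φ x)) (ψ (φ 1 + u)) := by
          refine Commute.map (Commute.add_right ?_ (hu x)) ψ
          rw [Commute, SemiconjBy, map_mul_map_one, map_one_mul_map]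
        have e2 : Commute (ψ (φ x)) (ψ (φ 1 - u)) := by
          refine Commute.map (Commute.sub_right ?_ (hu x)) ψ
          rw [Commute, SemiconjBy, map_mul_map_one, map_one_mul_map]
        exact ((e1.mul_right (hx₀ _)).add_right (e2.mul_right (hx₁ _))).sub_right
          ((hc.comm x).smul_right _)
      · have e1 : ψ (φ f) * (ψ (φ 1 + u) * x₀) = (2 : ℂ) • (x₀ * ψ (wt n (Pi.single i 1) * φ f)) := by
          rw [h2, map_smul, mul_smul_comm, smul_smul, mul_inv_cancel₀ two_ne_zero, one_smul,
            ← (hx₀ _).eq, ← mul_assoc, ← map_mul, mul_add, add_mul, map_mul_map_one,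
            map_one_mul_map, (hu f).eq]
        have e2 : ψ (φ f) * (ψ (φ 1 - u) * x₁) = (2 : ℂ) • (x₁ * ψ (wt n (Pi.single j 1) * φ f)) := by
          rw [h3, map_smul, mul_smul_comm, smul_smul, mul_inv_cancel₀ two_ne_zero, one_smul,
            ← (hx₁ _).eq, ← mul_assoc, ← map_mul, mul_sub, sub_mul, map_mul_map_one,
            map_one_mul_map, (hu f).eq]
        change ψ (φ f) * _ = 0
        have e3 : ψ (φ f) * c = c * ψ (φ f) := hc.comm f
        rw [mul_sub, mul_add, e1, e2, ← smul_add, ← h4, h5, mul_smul_comm, e3, smul_smul,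
          sub_self]
    have h7 : ψ (φ 1) * (ψ (φ 1 + u) * x₀ + ψ (φ 1 - u) * x₁ - (2 * ε) • c) =
        ψ (φ 1 + u) * x₀ + ψ (φ 1 - u) * x₁ - (2 * ε) • c := by
      have e3 : ψ (φ 1) * c = c := hc.one_mul
      rw [mul_sub, mul_add, ← mul_assoc, ← mul_assoc, ← map_mul, ← map_mul, mul_add, mul_sub,
        map_mul_map_one, hu', mul_smul_comm, e3]
    exact sub_eq_zero.1 (h7.symm.trans h6)
  have s₀ := step i u₀ 1 hu₀ hu₀' hs₀ (by
    rw [hgg]; ext a; by_cases h : a = i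
    · subst h; simp [hij]
    · simp [h]) (by
    rw [hg]; ext a; by_cases h : a = i
    · subst h; simp [hij]
    · simp [h])
  have s₁ := step j u₁ (-1) hu₁ hu₁' hs₁ (by
    rw [hgg]; ext a; by_cases h : a = j
    · subst h; simp [hij.symm]
    · simp [h]) (by
    rw [hg]; ext a; by_cases h : a = j
    · subst h; simp [hij.symm]
    · simp [h])
  -- Adding the equations for `ε = 1` and `ε = -1` eliminates `c`. Comparing coefficients gives `x₁
  -- = t • x₀` with `t = ±1`: `t = 1` would force `φ 1 = 0`, and `t = -1` gives `u₀ + u₁ = 0`.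
  have hsum : ψ ((2 : ℂ) • φ 1 + (u₀ + u₁)) * x₀ = ψ ((u₀ + u₁) - (2 : ℂ) • φ 1) * x₁ := by
    have h1 : ψ (φ 1 + u₀) * x₀ + ψ (φ 1 - u₀) * x₁ + (ψ (φ 1 + u₁) * x₀ + ψ (φ 1 - u₁) * x₁) =
        0 := by rw [s₀, s₁]; module
    rw [← sub_eq_zero, ← h1]
    simp only [map_add, map_sub, map_smul, add_mul, sub_mul, smul_mul_assoc]
    module
  have hent := smul_eq_smul_of_map_mul_eq hx₀ hx₁ hsum
  rw [hx₀', hx₁'] at hent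
  obtain ⟨q, r, hqr⟩ : ∃ q r, (φ 1) q r ≠ 0 := by
    by_contra! h'
    exact hφ0 (Matrix.ext h')
  have hx₀0 : x₀ ≠ 0 := by rintro rfl; exact hψ0 (by rw [← hx₀2, mul_zero])
  have hx₁0 : x₁ ≠ 0 := by rintro rfl; exact hψ0 (by rw [← hx₁2, mul_zero])
  obtain ⟨t, ht⟩ : ∃ t : ℂ, x₁ = t • x₀ := by
    have h1 := hent q r
    -- The two coefficients differ by four times the nonzero entry of `φ 1`, so they cannot both
    -- vanish.
    by_cases hB : (u₀ + u₁ - (2 : ℂ) • φ 1) q r = 0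
    · exfalso
      rw [hB, zero_smul] at h1
      have hA := (smul_eq_zero.1 h1).resolve_right hx₀0
      simp only [Matrix.add_apply, Matrix.sub_apply, Matrix.smul_apply, smul_eq_mul] at hA hB
      apply hqr
      linear_combination (hA - hB) / 4
    · exact ⟨_, by rw [← smul_smul, h1, inv_smul_smul₀ hB]⟩
  have htt : t * t = 1 := by
    have h1 : (t * t - 1) • ψ 1 = 0 := by
      rw [sub_smul, one_smul, sub_eq_zero]
      conv_rhs => rw [← hx₁2, ht, smul_mul_assoc, mul_smul_comm, hx₀2, smul_smul]
    exact sub_eq_zero.1 ((smul_eq_zero.1 h1).resolve_right hψ0)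
  have hent' : ∀ q r, ((2 : ℂ) • φ 1 + (u₀ + u₁)) q r = (u₀ + u₁ - (2 : ℂ) • φ 1) q r * t := by
    intro q r
    have h1 := hent q r
    rw [ht, smul_smul, ← sub_eq_zero, ← sub_smul] at h1
    exact sub_eq_zero.1 ((smul_eq_zero.1 h1).resolve_right hx₀0)
  rcases mul_self_eq_one_iff.1 htt with rfl | rfl
  · exfalso
    have h1 := hent' q r
    simp only [Matrix.add_apply, Matrix.sub_apply, Matrix.smul_apply, smul_eq_mul] at h1
    apply hqr
    linear_combination h1 / 4
  · refine ⟨?_, by rw [ht, neg_one_smul]⟩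
    ext q r
    have h1 := hent' q r
    simp only [Matrix.add_apply, Matrix.sub_apply, Matrix.smul_apply, smul_eq_mul] at h1
    rw [Matrix.neg_apply]
    linear_combination h1 / 2

end Signs

/-! ### Alignment of the factors; commuting against anticommuting signs -/

section Factors

variable {m n k l : Fin 4 → ℕ}

theorem IsStarExtEmbedding.map_one_ne_zero {φ : Mat m →⋆ₙₐ[ℂ] Mat n} (hφ : IsStarExtEmbedding φ)
    (o : Idx m) : φ 1 ≠ 0 := by
  have : Nonempty (Idx m) := ⟨o⟩
  exact fun h => one_ne_zero (hφ.1 (h.trans (map_zero φ).symm))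

/-- For each factor the block signs at `i` and `j` are opposite, as are the values of `g`, so they
combine into one sign. -/
theorem exists_isSignOf_of_comp {g : Fin 4 → ℂ} {i j : Fin 4} (hij : i ≠ j)
    (hg : g = Pi.single i 1 - Pi.single j 1)
    {φ : Mat m →⋆ₙₐ[ℂ] Mat n} {ψ : Mat n →⋆ₙₐ[ℂ] Mat k} (hm : ∀ i, 0 < m i) (hn : ∀ i, 0 < n i)
    (hφ : IsStarExtEmbedding φ) (hψ : IsStarExtEmbedding ψ)
    (hzφ : wt n (g * g) * φ 1 = φ (wt m (g * g))) (hzψ : wt k (g * g) * ψ 1 = ψ (wt n (g * g)))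
    {c : Mat k} (hc : IsSignOf g (ψ.comp φ) c) :
    ∃ u x, IsSignOf g φ u ∧ IsSignOf g ψ x := by
  have hstar : star g = g := by
    rw [hg, star_sub, ← Pi.single_star, ← Pi.single_star, star_one]
  have hgg : g * g = Pi.single i 1 + Pi.single j 1 := by
    rw [hg]
    ext a
    by_cases h1 : a = i
    · subst h1; simp [hij]
    · by_cases h2 : a = j
      · subst h2; simp [h1]
      · simp [h1, h2]
  have hggi : g * g * Pi.single i 1 = Pi.single i 1 := by
    rw [hgg]; ext a; by_cases h : a = i
    · subst h; simp [hij]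
    · simp [h]
  have hggj : g * g * Pi.single j 1 = Pi.single j 1 := by
    rw [hgg]; ext a; by_cases h : a = j
    · subst h; simp [hij.symm]
    · simp [h]
  have hggg : g * (g * g) = g := by
    conv_lhs => rw [mul_comm]; enter [2]; rw [hg]
    rw [mul_sub, hggi, hggj, ← hg]
  have range : ∀ {m n : Fin 4 → ℕ} {φ : Mat m →⋆ₙₐ[ℂ] Mat n},
      wt n (g * g) * φ 1 = φ (wt m (g * g)) → ∀ x, wt n (g * g) * φ x = φ (wt m (g * g) * x) := by
    intro m n φ h x
    rw [← map_one_mul_map, ← mul_assoc, h, map_mul]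
  have sign : ∀ {m n : Fin 4 → ℕ} {φ : Mat m →⋆ₙₐ[ℂ] Mat n} {u₀ u₁ : Mat n},
      wt n (g * g) * φ 1 = φ (wt m (g * g)) →
      wt n g * φ (wt m (Pi.single i 1)) = u₀ * φ (wt m (Pi.single i 1)) →
      wt n g * φ (wt m (Pi.single j 1)) = u₁ * φ (wt m (Pi.single j 1)) → u₁ = -u₀ →
      wt n g * φ 1 = u₀ * φ (wt m g) := by
    intro m n φ u₀ u₁ h h0 h1 h2
    conv_lhs => rw [← hggg, ← wt_mul_wt, mul_assoc, h, hgg, wt_add, map_add, mul_add, h0, h1, h2]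
    conv_rhs => rw [hg, sub_eq_add_neg, wt_add, ← neg_one_smul ℂ, wt_smul, map_add, map_smul]
    rw [mul_add, neg_mul, mul_smul_comm, neg_one_smul]
  have hri : ∀ {m n : Fin 4 → ℕ} {φ : Mat m →⋆ₙₐ[ℂ] Mat n},
      wt n (g * g) * φ 1 = φ (wt m (g * g)) →
      wt n (g * g) * φ (wt m (Pi.single i 1)) = φ (wt m (Pi.single i 1)) := fun h => by
    rw [range h, wt_mul_wt, hggi]
  have hrj : ∀ {m n : Fin 4 → ℕ} {φ : Mat m →⋆ₙₐ[ℂ] Mat n},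
      wt n (g * g) * φ 1 = φ (wt m (g * g)) →
      wt n (g * g) * φ (wt m (Pi.single j 1)) = φ (wt m (Pi.single j 1)) := fun h => by
    rw [range h, wt_mul_wt, hggj]
  obtain ⟨u₀, a1, a2, a3, a4, a5⟩ := exists_blockSign hstar hφ (hm i) (hri hzφ)
  obtain ⟨u₁, b1, b2, b3, b4, b5⟩ := exists_blockSign hstar hφ (hm j) (hrj hzφ)
  obtain ⟨x₀, c1, c2, c3, c4, c5⟩ := exists_blockSign hstar hψ (hn i) (hri hzψ)
  obtain ⟨x₁, d1, d2, d3, d4, d5⟩ := exists_blockSign hstar hψ (hn j) (hrj hzψ)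
  obtain ⟨hu, hx⟩ := eq_neg_of_comp hij hg hm (hφ.map_one_ne_zero ⟨i, ⟨0, hm i⟩⟩)
    (hψ.map_one_ne_zero ⟨i, ⟨0, hn i⟩⟩) (by
      rw [range hzφ, wt_mul_wt, mul_assoc, hggg])
    a2 b2 a3 b3 a5 b5 c2 d2 c3 d3 c4 d4 c5 d5 hc
  exact ⟨u₀, x₀, ⟨a1, a2, a3, a4, sign hzφ a5 b5 hu⟩, ⟨c1, c2, c3, c4, sign hzψ c5 d5 hx⟩⟩

theorem wt_gL_sq_mul_map_one {φ : Mat m →⋆ₙₐ[ℂ] Mat n}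
    (h1 : wt n (gR * gR) * φ (wt m (gL * gL)) = 0) (h2 : wt n (gL * gL) * φ (wt m (gR * gR)) = 0) :
    wt n (gL * gL) * φ 1 = φ (wt m (gL * gL)) := by
  rw [← wt_gL_sq_add_wt_gR_sq (n := m), map_add, mul_add, h2, add_zero]
  conv_rhs => rw [← one_mul (φ _), ← wt_gL_sq_add_wt_gR_sq, add_mul, h1, add_zero]

theorem wt_gR_sq_mul_map_one {φ : Mat m →⋆ₙₐ[ℂ] Mat n}
    (h1 : wt n (gR * gR) * φ (wt m (gL * gL)) = 0) (h2 : wt n (gL * gL) * φ (wt m (gR * gR)) = 0) :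
    wt n (gR * gR) * φ 1 = φ (wt m (gR * gR)) := by
  rw [← wt_gL_sq_add_wt_gR_sq (n := m), map_add, mul_add, h1, zero_add]
  conv_rhs => rw [← one_mul (φ _), ← wt_gL_sq_add_wt_gR_sq, add_mul, h2, zero_add]

theorem gL_eq : gL = Pi.single 0 1 - Pi.single 1 1 := by
  ext i; fin_cases i <;> simp [gL]

theorem gR_eq : gR = Pi.single 2 1 - Pi.single 3 1 := by
  ext i; fin_cases i <;> simp [gR]

/-- If the compositions of consecutive star extendible embeddings are aligned, so are the
embeddings themselves. -/
theorem exists_isAligned_of_comp {d : Fin 4 → ℕ} {φ : Mat m →⋆ₙₐ[ℂ] Mat n}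
    {ψ : Mat n →⋆ₙₐ[ℂ] Mat k} {χ : Mat k →⋆ₙₐ[ℂ] Mat l} {ω : Mat l →⋆ₙₐ[ℂ] Mat d}
    (hm : ∀ i, 0 < m i) (hn : ∀ i, 0 < n i) (hk : ∀ i, 0 < k i)
    (hφ : IsStarExtEmbedding φ) (hψ : IsStarExtEmbedding ψ) (hχ : IsStarExtEmbedding χ)
    (hω : IsStarExtEmbedding ω) {u v : Mat k} (h1 : IsAligned (ψ.comp φ) u v)
    {u' v' : Mat l} (h2 : IsAligned (χ.comp ψ) u' v')
    {u'' v'' : Mat d} (h3 : IsAligned (ω.comp χ) u'' v'') :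
    (∃ u v, IsAligned φ u v) ∧ ∃ x y, IsAligned ψ x y := by
  -- Preservation of the vertex pairs by a map uses the two maps after it, so treating both `φ` and
  -- `ψ` requires `χ` and `ω`.
  have e1 := wt_gR_sq_mul_map_eq_zero hn hψ hχ h1 h2
  have e2 := wt_gL_sq_mul_map_eq_zero hn hψ hχ h1 h2
  have e3 := wt_gR_sq_mul_map_eq_zero hk hχ hω h2 h3
  have e4 := wt_gL_sq_mul_map_eq_zero hk hχ hω h2 h3
  obtain ⟨a, b, ha, hb⟩ := exists_isSignOf_of_comp (by decide) gL_eq hm hn hφ hψ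
    (wt_gL_sq_mul_map_one e1 e2) (wt_gL_sq_mul_map_one e3 e4) h1.left
  obtain ⟨a', b', ha', hb'⟩ := exists_isSignOf_of_comp (by decide) gR_eq hm hn hφ hψ
    (wt_gR_sq_mul_map_one e1 e2) (wt_gR_sq_mul_map_one e3 e4) h1.right
  exact ⟨⟨a, a', ha, ha'⟩, ⟨b, b', hb, hb'⟩⟩

theorem wt_gL_ne_zero (hm : ∀ i, 0 < m i) : wt m gL ≠ 0 :=
  wt_ne_zero hm (i := 0) (by simp [gL])

theorem wt_gR_ne_zero (hm : ∀ i, 0 < m i) : wt m gR ≠ 0 :=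
  wt_ne_zero hm (i := 2) (by simp [gR])

/-- If the signs of a composition commute, then the signs of both factors commute, or the signs of
both factors anticommute. -/
theorem commute_or_anticommute {φ : Mat m →⋆ₙₐ[ℂ] Mat n} {ψ : Mat n →⋆ₙₐ[ℂ] Mat k}
    (hm : ∀ i, 0 < m i) (hφ0 : φ 1 ≠ 0) (hψ0 : ψ 1 ≠ 0) {u v : Mat n} (h : IsAligned φ u v)
    {x y : Mat k} (h' : IsAligned ψ x y) {c d : Mat k} (hc : IsAligned (ψ.comp φ) c d)
    (hcd : Commute c d) :
    (Commute u v ∧ Commute x y) ∨ (u * v = -(v * u) ∧ x * y = -(y * x)) := by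
  have hcomp := h.comp h'
  rw [hc.left.eq hcomp.left (wt_gL_ne_zero hm), hc.right.eq hcomp.right (wt_gR_ne_zero hm)] at hcd
  have hxy : ∀ a, Commute (ψ a) (x * y) := fun a => (h'.left.comm a).mul_right (h'.right.comm a)
  have hyx : ∀ a, Commute (ψ a) (y * x) := fun a => (h'.right.comm a).mul_right (h'.left.comm a)
  -- The signs of the composition are `ψ u * x` and `ψ v * y` by uniqueness; this is their
  -- commutation, sorted into range and commutant of `ψ`.
  have key : ψ (u * v) * (x * y) = ψ (v * u) * (y * x) := by
    have e1 : ψ (u * v) * (x * y) = ψ u * x * (ψ v * y) := by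
      rw [map_mul, mul_assoc, ← mul_assoc (ψ v), (h'.left.comm v).eq]
      simp only [mul_assoc]
    have e2 : ψ (v * u) * (y * x) = ψ v * y * (ψ u * x) := by
      rw [map_mul, mul_assoc, ← mul_assoc (ψ u), (h'.right.comm u).eq]
      simp only [mul_assoc]
    rw [e1, e2, hcd.eq]
  have hent := smul_eq_smul_of_map_mul_eq hxy hyx key
  rw [← mul_assoc, ← mul_assoc, h'.left.one_mul, h'.right.one_mul] at hent
  have hx3 : x * (x * y) * x = y * x := by
    rw [← mul_assoc, h'.left.sq, h'.right.one_mul]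
  have hx4 : x * (y * x) * x = x * y := by
    rw [mul_assoc, mul_assoc, h'.left.sq, ← (h'.right.comm 1).eq, h'.right.one_mul]
  have hyx0 : y * x ≠ 0 := by
    intro h0
    apply hψ0
    have e := congrArg (y * ·) h0
    simp only [mul_zero, ← mul_assoc, h'.right.sq, h'.left.one_mul] at e
    rw [← h'.left.sq, e, mul_zero]
  have hxy0 : x * y ≠ 0 := fun h0 => hyx0 (by rw [← hx3, h0, mul_zero, zero_mul])
  obtain ⟨q, r, hqr⟩ : ∃ q r, (u * v) q r ≠ 0 := by
    by_contra! h0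
    have h1 : u * v = 0 := Matrix.ext h0
    apply hφ0
    have e := congrArg (· * v) h1
    simp only [zero_mul, mul_assoc, h.right.sq, h.left.mul_map_one] at e
    rw [← h.left.sq, e, mul_zero]
  obtain ⟨t, ht⟩ : ∃ t : ℂ, x * y = t • (y * x) :=
    ⟨_, by rw [← smul_smul, ← hent q r, inv_smul_smul₀ hqr]⟩
  -- Conjugation by `x` exchanges `x * y` and `y * x`, so `t` equals its inverse.
  have htt : t * t = 1 := by
    have e1 : y * x = t • (x * y) := by
      rw [← hx3, ht, mul_smul_comm, smul_mul_assoc, hx4, ht]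
    have e2 : (t * t - 1) • (y * x) = 0 := by
      rw [sub_smul, one_smul, ← smul_smul, ← ht, ← e1, sub_self]
    exact sub_eq_zero.1 ((smul_eq_zero.1 e2).resolve_right hyx0)
  have huv : v * u = t • (u * v) := by
    ext q r
    have e1 := hent q r
    rw [ht, smul_smul, ← sub_eq_zero, ← sub_smul] at e1
    have e2 := (smul_eq_zero.1 e1).resolve_right hyx0
    rw [Matrix.smul_apply, smul_eq_mul]
    linear_combination -e2
  rcases mul_self_eq_one_iff.1 htt with rfl | rfl
  · left
    rw [one_smul] at ht huv
    exact ⟨huv.symm, ht⟩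
  · right
    rw [neg_one_smul] at ht huv
    exact ⟨by rw [huv, neg_neg], ht⟩

theorem IsAligned.not_anticommute {φ : Mat m →⋆ₙₐ[ℂ] Mat n} (hφ0 : φ 1 ≠ 0) {u v : Mat n}
    (h : IsAligned φ u v) (huv : Commute u v) : u * v ≠ -(v * u) := by
  intro h1
  rw [← huv.eq, eq_neg_iff_add_eq_zero, ← two_smul ℂ] at h1
  have h2 := (smul_eq_zero.1 h1).resolve_left two_ne_zero
  apply hφ0
  have e := congrArg (· * v) h2
  simp only [zero_mul, mul_assoc, h.right.sq, h.left.mul_map_one] at e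
  rw [← h.left.sq, e, mul_zero]

/-- An embedding with anticommuting signs can be conjugated to one with commuting signs. -/
theorem IsAligned.exists_commuting {φ : Mat m →⋆ₙₐ[ℂ] Mat n} (hφ : Function.Injective φ)
    {u v : Mat n} (h : IsAligned φ u v) (huv : u * v = -(v * u)) :
    ∃ (φ' : Mat m →⋆ₙₐ[ℂ] Mat n) (u' v' : Mat n), IsAligned φ' u' v' ∧ Commute u' v' ∧
      Function.Injective φ' ∧ ∀ a, (φ' a).trace = (φ a).trace := by
  obtain ⟨r, hr, hrr⟩ : ∃ r : ℂ, star r = r ∧ r * r = 2⁻¹ := by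
    refine ⟨((√2)⁻¹ : ℝ), Complex.conj_ofReal _, ?_⟩
    rw [← Complex.ofReal_mul, ← mul_inv, Real.mul_self_sqrt (by norm_num)]
    norm_num
  -- As `u` and `v` anticommute, `(u + v) / √2` is again a self-adjoint symmetry, and conjugation by
  -- it turns `u` into `v`.
  set w := r • (u + v) with hw
  have w1 : wᴴ = w := by
    rw [hw, conjTranspose_smul, conjTranspose_add, h.left.star_eq, h.right.star_eq, hr]
  have w2 : ∀ x, Commute (φ x) w := fun x =>
    ((h.left.comm x).add_right (h.right.comm x)).smul_right r
  have w3 : w * w = φ 1 := by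
    rw [hw, smul_mul_assoc, mul_smul_comm, smul_smul, hrr, add_mul, mul_add, mul_add, h.left.sq,
      h.right.sq, huv]
    module
  have w4 : w * u * w = v := by
    have e1 : (u + v) * u * (u + v) = (2 : ℂ) • v := by
      have e2 : (u + v) * u * (u + v) =
          u * u * u + u * u * v + v * (u * u) + v * u * v := by noncomm_ring
      have e3 : v * u * v = -u := by
        rw [mul_assoc, huv, mul_neg, ← mul_assoc, h.right.sq, h.left.one_mul]
      rw [e2, e3, h.left.sq, h.left.one_mul, h.right.one_mul, h.right.mul_map_one]
      module
    rw [hw, smul_mul_assoc, smul_mul_assoc, mul_smul_comm, smul_smul, hrr, e1, smul_smul]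
    norm_num
  set lo := wt m (gL * gL) with hlo
  set hi := wt m (gR * gR) with hhi
  have lohi : lo + hi = 1 := wt_gL_sq_add_wt_gR_sq
  have los : loᴴ = lo := wt_conjTranspose (by rw [star_mul, star_gL])
  have his : hiᴴ = hi := wt_conjTranspose (by rw [star_mul, star_gR])
  have lo_hi : lo * hi = 0 := by
    rw [hlo, hhi, wt_mul_wt, mul_mul_mul_comm, gL_mul_gR, zero_mul, wt_zero]
  have hi_lo : hi * lo = 0 := by
    rw [hlo, hhi, wt_mul_wt, mul_comm, mul_mul_mul_comm, gL_mul_gR, zero_mul, wt_zero]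
  -- `D` is the identity over `{0, 1}` and `w` over `{2, 3}`. Hence `D * u * Dᴴ` is `u` over the
  -- first pair and `v` over the second, and serves as the sign of the conjugated map for both `gL`
  -- and `gR`; equal signs commute.
  set D := φ lo + w * φ hi with hD
  have hDs : Dᴴ = φ lo + φ hi * w := by
    rw [hD, conjTranspose_add, conjTranspose_mul, w1, ← map_conjTranspose', ← map_conjTranspose',
      los, his]
  have hDφ : ∀ x, D * φ x = φ (lo * x) + w * φ (hi * x) := fun x => by
    rw [hD, add_mul, mul_assoc, ← map_mul, ← map_mul]
  have hφD : ∀ x, φ x * Dᴴ = φ (x * lo) + φ (x * hi) * w := fun x => by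
    rw [hDs, mul_add, ← mul_assoc, ← map_mul, ← map_mul]
  have lo_lo : lo * lo = lo := by
    conv_rhs => rw [← mul_one lo, ← lohi, mul_add, lo_hi, add_zero]
  have hi_hi : hi * hi = hi := by
    conv_rhs => rw [← mul_one hi, ← lohi, mul_add, hi_lo, zero_add]
  have hDD : Dᴴ * D = φ 1 := by
    rw [hDs, add_mul, mul_assoc, hD, mul_add, mul_add, mul_add, ← mul_assoc w w, w3,
      map_one_mul_map, ← (w2 hi).eq, ← mul_assoc, ← (w2 lo).eq]
    simp only [← mul_assoc, ← map_mul, lo_lo, lo_hi, hi_lo, hi_hi, map_zero, zero_mul, add_zero,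
      zero_add, ← map_add, lohi]
  have hDD' : D * Dᴴ = φ 1 := by
    rw [hD, add_mul, hφD, mul_assoc, hφD, lo_lo, lo_hi, hi_lo, hi_hi, map_zero, zero_mul, add_zero,
      zero_add, (w2 hi).eq, ← mul_assoc, w3, map_one_mul_map, ← map_add, lohi]
  have hD1 : D * φ 1 = D := by
    rw [hDφ, mul_one, mul_one]
  have hd : ∀ x, Dᴴ * D * φ x = φ x := fun x => by rw [hDD, map_one_mul_map]
  have hd1 : conjHom φ D hd 1 = φ 1 := by
    rw [conjHom_apply, hD1, hDD']
  have sgn : ∀ {g : Fin 4 → ℂ}, D * (u * φ (wt m g)) * Dᴴ = wt n g * φ 1 →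
      IsSignOf g (conjHom φ D hd) (D * u * Dᴴ) := fun {g} hg =>
    { star_eq := by
        rw [conjTranspose_mul, conjTranspose_mul, conjTranspose_conjTranspose, h.left.star_eq,
          mul_assoc]
      comm := fun x => by
        rw [conjHom_apply]
        calc D * φ x * Dᴴ * (D * u * Dᴴ) = D * (φ x * (Dᴴ * D) * u) * Dᴴ := by noncomm_ring
          _ = D * (u * (Dᴴ * D) * φ x) * Dᴴ := by
            rw [hDD, map_mul_map_one, mul_assoc u, map_one_mul_map, (h.left.comm x).eq]
          _ = D * u * Dᴴ * (D * φ x * Dᴴ) := by noncomm_ring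
      one_mul := by
        rw [hd1, ← mul_assoc, ← mul_assoc, ← hDD', mul_assoc D, hDD, hD1]
      sq := by
        rw [hd1]
        calc D * u * Dᴴ * (D * u * Dᴴ) = D * (u * ((Dᴴ * D) * u)) * Dᴴ := by noncomm_ring
          _ = φ 1 := by rw [hDD, h.left.one_mul, h.left.sq, hD1, hDD']
      sign := by
        rw [hd1, ← hg, conjHom_apply]
        calc D * (u * φ (wt m g)) * Dᴴ = D * (u * (Dᴴ * D * φ (wt m g))) * Dᴴ := by rw [hd]
          _ = D * u * Dᴴ * (D * φ (wt m g) * Dᴴ) := by noncomm_ring }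
  have lo_L : lo * wt m gL = wt m gL := by
    rw [hlo, wt_mul_wt]; congr 1; ext i; fin_cases i <;> simp [gL]
  have hi_L : hi * wt m gL = 0 := by
    rw [hhi, wt_mul_wt, mul_assoc, mul_comm gR gL, gL_mul_gR, mul_zero, wt_zero]
  have hi_R : hi * wt m gR = wt m gR := by
    rw [hhi, wt_mul_wt]; congr 1; ext i; fin_cases i <;> simp [gR]
  have lo_R : lo * wt m gR = 0 := by
    rw [hlo, wt_mul_wt, mul_assoc, gL_mul_gR, mul_zero, wt_zero]
  have L_lo : wt m gL * lo = wt m gL := by rw [hlo, (commute_wt_wt _ _).eq, ← hlo, lo_L]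
  have L_hi : wt m gL * hi = 0 := by rw [hhi, (commute_wt_wt _ _).eq, ← hhi, hi_L]
  have R_lo : wt m gR * lo = 0 := by rw [hlo, (commute_wt_wt _ _).eq, ← hlo, lo_R]
  have R_hi : wt m gR * hi = wt m gR := by rw [hhi, (commute_wt_wt _ _).eq, ← hhi, hi_R]
  refine ⟨conjHom φ D hd, _, _, ⟨sgn ?_, sgn ?_⟩, Commute.refl _, conjHom_injective hφ D hd,
    fun a => trace_conjHom D hd a⟩
  · rw [mul_assoc, mul_assoc, hφD, L_lo, L_hi, map_zero, zero_mul, add_zero, ← (h.left.comm _).eq,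
      ← mul_assoc, hDφ, lo_L, hi_L, map_zero, mul_zero, add_zero, h.left.sign, (h.left.comm _).eq]
  · rw [mul_assoc, mul_assoc, hφD, R_lo, R_hi, map_zero, zero_add, ← mul_assoc u,
      ← (h.left.comm _).eq, mul_assoc, ← mul_assoc D, hDφ, lo_R, hi_R, map_zero, zero_add,
      ← (w2 _).eq, mul_assoc, ← mul_assoc w, w4, h.right.sign, (h.right.comm _).eq]

end Factors

/-! ### Traceless signs -/

section Balanced

variable {m n k : Fin 4 → ℕ} {φ : Mat m →⋆ₙₐ[ℂ] Mat n} {ψ : Mat n →⋆ₙₐ[ℂ] Mat k}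

/-- The four symmetries of `D_4` occur with equal multiplicity: the signs are traceless. -/
structure IsBalanced (φ : Mat m →⋆ₙₐ[ℂ] Mat n) (u v : Mat n) : Prop extends IsAligned φ u v where
  trace_left : ∀ a, (u * φ a).trace = 0
  trace_right : ∀ a, (v * φ a).trace = 0
  trace_mul : ∀ a, (u * v * φ a).trace = 0

/-- The signs of `φ` commute. -/
def HasCommutingSigns (φ : Mat m →⋆ₙₐ[ℂ] Mat n) : Prop :=
  ∃ u v, IsAligned φ u v ∧ Commute u v

/-- The signs of `φ` commute and are traceless. -/
def HasBalancedSigns (φ : Mat m →⋆ₙₐ[ℂ] Mat n) : Prop :=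
  ∃ u v, IsBalanced φ u v ∧ Commute u v

/-- The signs of `φ` anticommute. -/
def HasAnticommutingSigns (φ : Mat m →⋆ₙₐ[ℂ] Mat n) : Prop :=
  ∃ u v, IsAligned φ u v ∧ u * v = -(v * u)

/-- By cyclicity `tr (x v v) = tr (v x v)`, which is `-tr (x v v)` by anticommutation. -/
theorem trace_eq_zero_of_anticommute {x v : Mat n} (h : x * v = -(v * x)) (h' : x * v * v = x) :
    x.trace = 0 := by
  have h1 : (x * v * v).trace = -(x * v * v).trace := by
    conv_lhs => rw [trace_mul_comm, ← mul_assoc]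
    rw [← trace_neg, ← neg_mul, h, neg_neg]
  rw [h'] at h1
  linear_combination (1 / 2 : ℂ) * h1

/-- Each of `u * φ a`, `v * φ a`, `u * v * φ a` anticommutes with `u` or with `v`. -/
theorem IsAligned.isBalanced_of_anticommute {u v : Mat n} (h : IsAligned φ u v)
    (huv : u * v = -(v * u)) : IsBalanced φ u v where
  toIsAligned := h
  trace_left a := by
    refine trace_eq_zero_of_anticommute (v := v) ?_ ?_
    · rw [mul_assoc, (h.right.comm a).eq, ← mul_assoc, huv, neg_mul, mul_assoc]
    · rw [mul_assoc, mul_assoc, h.right.sq, map_mul_map_one]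
  trace_right a := by
    refine trace_eq_zero_of_anticommute (v := u) ?_ ?_
    · rw [mul_assoc, (h.left.comm a).eq, ← mul_assoc, ← neg_eq_iff_eq_neg.2 huv, neg_mul,
        mul_assoc]
    · rw [mul_assoc, mul_assoc, h.left.sq, map_mul_map_one]
  trace_mul a := by
    refine trace_eq_zero_of_anticommute (v := v) ?_ ?_
    · rw [mul_assoc, (h.right.comm a).eq, ← mul_assoc, huv, neg_mul, neg_mul, neg_mul, mul_neg,
        neg_inj, mul_assoc v u v, huv]
      simp only [mul_assoc, mul_neg, neg_mul]
    · rw [mul_assoc, mul_assoc, h.right.sq, map_mul_map_one]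

theorem HasBalancedSigns.hasCommutingSigns (h : HasBalancedSigns φ) : HasCommutingSigns φ :=
  let ⟨u, v, h1, h2⟩ := h
  ⟨u, v, h1.toIsAligned, h2⟩

/-- Each trace has the form `tr (ψ b * z)` with `z` in the commutant of `ψ` and `tr b = 0`. -/
theorem IsBalanced.comp {u v : Mat n} {x y : Mat k} (h : IsBalanced φ u v) (h' : IsAligned ψ x y) :
    IsBalanced (ψ.comp φ) (ψ u * x) (ψ v * y) where
  toIsAligned := h.toIsAligned.comp h'
  trace_left a := by
    change (ψ u * x * ψ (φ a)).trace = 0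
    rw [mul_assoc, ← (h'.left.comm _).eq, ← mul_assoc, ← map_mul]
    exact trace_map_mul_eq_zero h'.left.comm (h.trace_left a)
  trace_right a := by
    change (ψ v * y * ψ (φ a)).trace = 0
    rw [mul_assoc, ← (h'.right.comm _).eq, ← mul_assoc, ← map_mul]
    exact trace_map_mul_eq_zero h'.right.comm (h.trace_right a)
  trace_mul a := by
    have hxy : ∀ b, Commute (ψ b) (x * y) := fun b => (h'.left.comm b).mul_right (h'.right.comm b)
    change (ψ u * x * (ψ v * y) * ψ (φ a)).trace = 0
    have e : ψ u * x * (ψ v * y) * ψ (φ a) = ψ (u * v * φ a) * (x * y) := by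
      rw [mul_assoc (ψ u), ← mul_assoc x, ← (h'.left.comm v).eq, mul_assoc (ψ v), ← mul_assoc,
        mul_assoc, ← (hxy _).eq, ← mul_assoc, ← map_mul, ← map_mul]
    rw [e]
    exact trace_map_mul_eq_zero hxy (h.trace_mul a)

theorem IsBalanced.comp_of_isAligned {u v : Mat n} {x y : Mat k} (h' : IsBalanced ψ x y)
    (h : IsAligned φ u v) : IsBalanced (ψ.comp φ) (ψ u * x) (ψ v * y) where
  toIsAligned := h.comp h'.toIsAligned
  trace_left a := by
    change (ψ u * x * ψ (φ a)).trace = 0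
    rw [(h'.left.comm u).eq, mul_assoc, ← map_mul, h'.trace_left]
  trace_right a := by
    change (ψ v * y * ψ (φ a)).trace = 0
    rw [(h'.right.comm v).eq, mul_assoc, ← map_mul, h'.trace_right]
  trace_mul a := by
    change (ψ u * x * (ψ v * y) * ψ (φ a)).trace = 0
    have e : ψ u * x * (ψ v * y) * ψ (φ a) = x * y * ψ (u * v * φ a) := by
      rw [(h'.left.comm u).eq, (h'.right.comm v).eq, mul_assoc x, ← mul_assoc (ψ u),
        (h'.right.comm u).eq, mul_assoc y, ← map_mul, ← mul_assoc, mul_assoc (x * y), ← map_mul]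
    rw [e, h'.trace_mul]

theorem HasBalancedSigns.comp_of_hasCommutingSigns (h' : HasBalancedSigns ψ)
    (h : HasCommutingSigns φ) : HasBalancedSigns (ψ.comp φ) :=
  let ⟨_, _, h1, h2⟩ := h
  let ⟨_, _, h3, h4⟩ := h'
  ⟨_, _, h3.comp_of_isAligned h1, h3.toIsAligned.commute_comp h2 h4⟩

theorem HasBalancedSigns.comp (h : HasBalancedSigns φ) (h' : HasCommutingSigns ψ) :
    HasBalancedSigns (ψ.comp φ) :=
  let ⟨_, _, h1, h2⟩ := h
  let ⟨_, _, h3, h4⟩ := h'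
  ⟨_, _, h1.comp h3, h3.commute_comp h2 h4⟩

/-- The two minus signs cancel, so the composed signs commute, while their traces stay zero. This
shows that the given maps between stages of an anticommuting zigzag are balanced. -/
theorem HasAnticommutingSigns.comp (h : HasAnticommutingSigns φ) (h' : HasAnticommutingSigns ψ) :
    HasBalancedSigns (ψ.comp φ) := by
  obtain ⟨u, v, h1, h2⟩ := h
  obtain ⟨x, y, h3, h4⟩ := h'
  refine ⟨_, _, (h1.isBalanced_of_anticommute h2).comp h3, ?_⟩
  rw [Commute, SemiconjBy, mul_assoc, ← mul_assoc x, ← (h3.left.comm v).eq, mul_assoc, h4, mul_assoc,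
    ← mul_assoc y, ← (h3.right.comm u).eq, mul_assoc (ψ u), ← mul_assoc, ← mul_assoc (ψ v),
    ← map_mul, ← map_mul, h2, map_neg, neg_mul_neg]

theorem HasAnticommutingSigns.exists_commuting (h : HasAnticommutingSigns φ)
    (hφ : Function.Injective φ) : ∃ φ' : Mat m →⋆ₙₐ[ℂ] Mat n, HasCommutingSigns φ' ∧
      Function.Injective φ' ∧ ∀ a, (φ' a).trace = (φ a).trace := by
  obtain ⟨u, v, h1, h2⟩ := h
  obtain ⟨φ', u', v', h3, h4, h5, h6⟩ := h1.exists_commuting hφ h2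
  exact ⟨φ', ⟨u', v', h3, h4⟩, h5, h6⟩

/-- An embedding can be conjugated so that its composition with a given balanced embedding becomes
a given balanced embedding with the same trace. -/
theorem HasBalancedSigns.exists_comp_eq (o : Idx m) (hφ : HasBalancedSigns φ)
    (hψ : HasCommutingSigns ψ) (hψ' : Function.Injective ψ) {θ : Mat m →⋆ₙₐ[ℂ] Mat k}
    (hθ : HasBalancedSigns θ) (htr : ∀ a, (ψ (φ a)).trace = (θ a).trace) :
    ∃ ψ' : Mat n →⋆ₙₐ[ℂ] Mat k, HasCommutingSigns ψ' ∧ Function.Injective ψ' ∧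
      (∀ a, (ψ' a).trace = (ψ a).trace) ∧ ψ'.comp φ = θ := by
  obtain ⟨u, v, h1, h2⟩ := hφ.comp hψ
  obtain ⟨u', v', h3, h4⟩ := hθ
  obtain ⟨x, y, h5, h6⟩ := hψ
  -- Both maps are balanced, so only the ordinary traces have to be compared.
  obtain ⟨U, hU, -, hU', hUθ⟩ := exists_unitary_conj h1.toIsAligned h2 h3.toIsAligned h4 o htr
    (fun a => by rw [h1.trace_left, h3.trace_left])
    (fun a => by rw [h1.trace_right, h3.trace_right])
    (fun a => by rw [h1.trace_mul, h3.trace_mul])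
  have hd : ∀ a, Uᴴ * U * ψ a = ψ a := fun a => by rw [hU, one_mul]
  refine ⟨conjHom ψ U hd, ⟨_, _, ⟨h5.left.conj hU (hU' _) hd, h5.right.conj hU (hU' _) hd⟩, ?_⟩,
    conjHom_injective hψ' U hd, trace_conjHom U hd, NonUnitalStarAlgHom.ext hUθ⟩
  have e : ∀ a b, U * a * Uᴴ * (U * b * Uᴴ) = U * (a * b) * Uᴴ := fun a b => by
    calc U * a * Uᴴ * (U * b * Uᴴ) = U * a * (Uᴴ * U) * b * Uᴴ := by simp only [mul_assoc]
      _ = U * (a * b) * Uᴴ := by rw [hU, mul_one]; simp only [mul_assoc]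
  rw [Commute, SemiconjBy, e, e, h6.eq]

theorem HasCommutingSigns.isRegular (h : HasCommutingSigns φ) (hφ : Function.Injective φ)
    (o : Idx m) : IsRegular φ :=
  let ⟨_, _, h1, h2⟩ := h
  h1.isRegular h2 hφ o

end Balanced

/-- Dependent choice in two alternating sorts; the types `α k`, `β k` will carry the properties to
be preserved along the recursion. -/
theorem exists_interlacing {α β : ℕ → Type*} {P : ∀ k, α k → β k → Prop}
    {Q : ∀ k, β k → α (k + 1) → Prop} (a₀ : α 0) (hP : ∀ k a, ∃ b, P k a b)
    (hQ : ∀ k b, ∃ a, Q k b a) :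
    ∃ (a : ∀ k, α k) (b : ∀ k, β k), (∀ k, P k (a k) (b k)) ∧ ∀ k, Q k (b k) (a (k + 1)) := by
  choose F hF using hP
  choose G hG using hQ
  let a : ∀ k, α k := fun k => Nat.rec a₀ (fun k a => G k (F k a)) k
  exact ⟨a, fun k => F k (a k), fun k => hF k _, fun k => hG k _⟩

/-! ### Replacing a zigzag by a regular one -/

namespace Zigzag

variable {S S' : DirectSys}

/-- The signs of all the embeddings of a zigzag between rigid systems commute, or the signs of all
of them anticommute. -/
theorem commuting_or_anticommuting (Z : Zigzag S S') (hS : ∀ k, IsRigid (S.map k))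
    (hS' : ∀ k, IsRigid (S'.map k)) :
    (∀ k, HasCommutingSigns (Z.φ k) ∧ HasCommutingSigns (Z.ψ k)) ∨
      ∀ k, HasAnticommutingSigns (Z.φ k) ∧ HasAnticommutingSigns (Z.ψ k) := by
  have hψφ : ∀ k, HasCommutingSigns ((Z.ψ k).comp (Z.φ k)) := fun k => by
    rw [Z.ψφ]
    exact DirectSys.exists_isAligned_trans hS _
  have hφψ : ∀ k, HasCommutingSigns ((Z.φ (k + 1)).comp (Z.ψ k)) := fun k => by
    rw [Z.φψ]
    exact DirectSys.exists_isAligned_trans hS' _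
  have hal : ∀ k, (∃ u v, IsAligned (Z.φ k) u v) ∧ ∃ x y, IsAligned (Z.ψ k) x y := fun k => by
    obtain ⟨_, _, h1, -⟩ := hψφ k
    obtain ⟨_, _, h2, -⟩ := hφψ k
    obtain ⟨_, _, h3, -⟩ := hψφ (k + 1)
    exact exists_isAligned_of_comp (S.dim_pos _) (S'.dim_pos _) (S.dim_pos _) (Z.hφ k) (Z.hψ k)
      (Z.hφ (k + 1)) (Z.hψ (k + 1)) h1 h2 h3
  choose u v huv using fun k => (hal k).1
  choose x y hxy using fun k => (hal k).2
  have hφ0 : ∀ k, Z.φ k 1 ≠ 0 := fun k =>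
    (Z.hφ k).map_one_ne_zero ⟨0, ⟨0, S.dim_pos _ _⟩⟩
  have hψ0 : ∀ k, Z.ψ k 1 ≠ 0 := fun k =>
    (Z.hψ k).map_one_ne_zero ⟨0, ⟨0, S'.dim_pos _ _⟩⟩
  have d1 : ∀ k, (Commute (u k) (v k) ∧ Commute (x k) (y k)) ∨
      (u k * v k = -(v k * u k) ∧ x k * y k = -(y k * x k)) := fun k => by
    obtain ⟨_, _, h1, h2⟩ := hψφ k
    exact commute_or_anticommute (S.dim_pos _) (hφ0 k) (hψ0 k) (huv k) (hxy k) h1 h2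
  have d2 : ∀ k, (Commute (x k) (y k) ∧ Commute (u (k + 1)) (v (k + 1))) ∨
      (x k * y k = -(y k * x k) ∧ u (k + 1) * v (k + 1) = -(v (k + 1) * u (k + 1))) := fun k => by
    obtain ⟨_, _, h1, h2⟩ := hφψ k
    exact commute_or_anticommute (S'.dim_pos _) (hψ0 k) (hφ0 (k + 1)) (hxy k) (huv (k + 1)) h1 h2
  have n1 : ∀ k, Commute (u k) (v k) → u k * v k ≠ -(v k * u k) := fun k =>
    (huv k).not_anticommute (hφ0 k)
  have n2 : ∀ k, Commute (x k) (y k) → x k * y k ≠ -(y k * x k) := fun k =>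
    (hxy k).not_anticommute (hψ0 k)
  -- Neighbouring maps are of the same kind and no map is of both kinds, so the kind of the first
  -- propagates along the zigzag.
  rcases d1 0 with h0 | h0
  · left
    have hC : ∀ k, Commute (u k) (v k) ∧ Commute (x k) (y k) := fun k => by
      induction k with
      | zero => exact h0
      | succ k ih =>
        have h1 := (d2 k).resolve_right fun h => n2 k ih.2 h.1
        exact (d1 (k + 1)).resolve_right fun h => n1 (k + 1) h1.2 h.1
    exact fun k => ⟨⟨_, _, huv k, (hC k).1⟩, ⟨_, _, hxy k, (hC k).2⟩⟩
  · right
    have hA : ∀ k, u k * v k = -(v k * u k) ∧ x k * y k = -(y k * x k) := fun k => by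
      induction k with
      | zero => exact h0
      | succ k ih =>
        have h1 := (d2 k).resolve_left fun h => n2 k h.1 ih.2
        exact (d1 (k + 1)).resolve_left fun h => n1 (k + 1) h.1 h1.2
    exact fun k => ⟨⟨_, _, huv k, (hA k).1⟩, ⟨_, _, hxy k, (hA k).2⟩⟩

theorem regularlyIsomorphic_of_anticommuting (Z : Zigzag S S')
    (hA : ∀ k, HasAnticommutingSigns (Z.φ k) ∧ HasAnticommutingSigns (Z.ψ k)) :
    RegularlyIsomorphic S S' := by
  have hT : ∀ k, HasBalancedSigns
      (S.trans (Z.n k) (Z.n (k + 1)) (Z.hn.monotone (Nat.le_succ k))) := fun k => by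
    rw [← Z.ψφ]
    exact (hA k).1.comp (hA k).2
  have hT' : ∀ k, HasBalancedSigns
      (S'.trans (Z.m k) (Z.m (k + 1)) (Z.hm.monotone (Nat.le_succ k))) := fun k => by
    rw [← Z.φψ]
    exact (hA k).2.comp (hA (k + 1)).1
  choose φ' h1 h2 h3 using fun k => (hA k).1.exists_commuting (Z.hφ k).1
  choose ψ' k1 k2 k3 using fun k => (hA k).2.exists_commuting (Z.hψ k).1
  -- Going from `n (2k)` to `m (2k+1)` leaves room for a given connecting map before the modified
  -- `φ' (2k+1)`. That map is balanced, which makes every inner map passed to `exists_comp_eq`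
  -- balanced.
  have hn : StrictMono fun k => Z.n (2 * k) := Z.hn.comp fun a b h => by omega
  have hm : StrictMono fun k => Z.m (2 * k + 1) := Z.hm.comp fun a b h => by omega
  let α : ℕ → Type := fun k => {f : Mat (S.dim (Z.n (2 * k))) →⋆ₙₐ[ℂ] Mat (S'.dim (Z.m (2 * k + 1))) //
    HasBalancedSigns f ∧ Function.Injective f ∧ ∀ a, (f a).trace =
      (Z.φ (2 * k + 1) (S.trans _ _ (Z.hn.monotone (Nat.le_succ (2 * k))) a)).trace}
  let β : ℕ → Type := fun k =>
    {g : Mat (S'.dim (Z.m (2 * k + 1))) →⋆ₙₐ[ℂ] Mat (S.dim (Z.n (2 * (k + 1)))) //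
    HasCommutingSigns g ∧ Function.Injective g ∧ ∀ a, (g a).trace = (Z.ψ (2 * k + 1) a).trace}
  obtain ⟨f, g, hfg, hgf⟩ := exists_interlacing (α := α) (β := β)
    (P := fun k f g => g.1.comp f.1 = S.trans _ _ (hn.monotone (Nat.le_succ k)))
    (Q := fun k g f => f.1.comp g.1 = S'.trans _ _ (hm.monotone (Nat.le_succ k)))
    ⟨(φ' 1).comp (S.trans (Z.n 0) (Z.n 1) (Z.hn.monotone (Nat.le_succ 0))), (hT 0).comp (h1 1),
      (h2 1).comp (S.trans_injective _), fun a => h3 1 _⟩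
    (fun k f => by
      obtain ⟨g, e1, e2, e3, e4⟩ := f.2.1.exists_comp_eq ⟨0, ⟨0, S.dim_pos _ _⟩⟩ (k1 (2 * k + 1))
        (k2 (2 * k + 1)) (θ := S.trans _ _ (hn.monotone (Nat.le_succ k)))
        (by
          have := (hT (2 * k)).comp (hT (2 * k + 1)).hasCommutingSigns
          rwa [S.trans_comp] at this)
        (fun a => by
          -- The modified maps have the traces of the original ones, and the trace of an image
          -- depends only on the trace of the argument; so the trace is computed in the original
          -- commuting diagram.
          rw [k3, trace_map_eq_of_trace_eq (f.2.2.2 a), Z.ψφ_apply, S.trans_trans])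
      exact ⟨⟨g, e1, e2, fun a => (e3 a).trans (k3 _ _)⟩, e4⟩)
    (fun k g => by
      obtain ⟨f, e1, e2, e3, e4⟩ := HasBalancedSigns.exists_comp_eq
        -- The connecting map is grouped with `g` so that the inner map is balanced; only `φ'` is
        -- conjugated, and the connecting map is joined to the result afterwards.
        (φ := (S.trans _ _ (Z.hn.monotone (Nat.le_succ (2 * (k + 1))))).comp g.1)
        ⟨0, ⟨0, S'.dim_pos _ _⟩⟩ ((hT _).comp_of_hasCommutingSigns g.2.1)
        (h1 (2 * (k + 1) + 1)) (h2 (2 * (k + 1) + 1)) (θ := S'.trans _ _ (hm.monotone (Nat.le_succ k)))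
        (by
          have := (hT' (2 * k + 1)).comp (hT' (2 * k + 2)).hasCommutingSigns
          rwa [S'.trans_comp] at this)
        (fun a => by
          rw [h3]
          change (Z.φ _ (S.trans _ _ _ (g.1 a))).trace = _
          rw [trace_map_eq_of_trace_eq (trace_map_eq_of_trace_eq (g.2.2.2 a)),
            ← Z.ψφ_apply, Z.φψ_apply]
          exact congrArg trace ((congrArg _ (Z.φψ_apply (2 * k + 1) a)).trans
            (S'.trans_trans _ _ a)))
      exact ⟨⟨f.comp (S.trans _ _ (Z.hn.monotone (Nat.le_succ (2 * (k + 1))))), (hT _).comp e1,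
        e2.comp (S.trans_injective _), fun a => (e3 _).trans (h3 _ _)⟩, e4⟩)
  exact ⟨_, _, hn, hm, fun k => (f k).1, fun k => (g k).1,
    fun k => (f k).2.1.hasCommutingSigns.isRegular (f k).2.2.1 ⟨0, ⟨0, S.dim_pos _ _⟩⟩,
    fun k => (g k).2.1.isRegular (g k).2.2.1 ⟨0, ⟨0, S'.dim_pos _ _⟩⟩, hfg, hgf⟩

theorem regularlyIsomorphic (Z : Zigzag S S') (hS : ∀ k, IsRigid (S.map k))
    (hS' : ∀ k, IsRigid (S'.map k)) :
    RegularlyIsomorphic S S' := by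
  rcases Z.commuting_or_anticommuting hS hS' with h | h
  · exact ⟨Z.n, Z.m, Z.hn, Z.hm, Z.φ, Z.ψ,
      fun k => (h k).1.isRegular (Z.hφ k).1 ⟨0, ⟨0, S.dim_pos _ _⟩⟩,
      fun k => (h k).2.isRegular (Z.hψ k).1 ⟨0, ⟨0, S'.dim_pos _ _⟩⟩, Z.ψφ, Z.φψ⟩
  · exact Z.regularlyIsomorphic_of_anticommuting h

end Zigzag

theorem RegularlyIsomorphic.starExtendiblyIsomorphic {S S' : DirectSys}
    (h : RegularlyIsomorphic S S') : StarExtendiblyIsomorphic S S' := by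
  obtain ⟨n, m, hn, hm, φ, ψ, hφ, hψ, h1, h2⟩ := h
  exact Zigzag.starExtendiblyIsomorphic
    ⟨n, m, hn, hm, φ, ψ, fun k => (hφ k).1, fun k => (hψ k).1, h1, h2⟩

end FourCycle

theorem theorem4p2 (S S' : FourCycle.DirectSys) (hS : S.IsGeneric) (hS' : S'.IsGeneric) :
    FourCycle.StarExtendiblyIsomorphic S S' ↔ FourCycle.RegularlyIsomorphic S S' := by
  refine ⟨fun h => ?_, fun h => h.starExtendiblyIsomorphic⟩
  obtain ⟨Z⟩ := h.exists_zigzag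
  exact Z.regularlyIsomorphic hS.1 hS'.1
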